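/- Let $k\ge 1$ and $n\ge 0$ be integers. Let $\mathrm{row}_k$ be the linear map on the ring of symmetric functions over $\mathbb{Q}$ given on the monomial basis by $\mathrm{row}_k(m_\lambda)=m_{\lambda/k}$ if all parts of $\lambda$ are divisible by $k$ (where $\lambda/k$ is obtained by dividing every part by $k$), and $\mathrm{row}_k(m_\lambda)=0$ otherwise. For a partition $\nu$ let $\ell(\nu)$ be its number of parts, let $e_\nu=e_{\nu_1}e_{\nu_2}\cdots$ be the elementary symmetric function, and for a symmetric function $f$ let $[e_\nu]f$ be the coefficient of $e_\nu$ in the expansion of $f$ in the basis of elementary symmetric functions. Let $\mathrm{SH}(0)$ be the ribbon skew shape (English notation) with $n$ columns of $k$ cells each, in which the top cell of each column lies in the same row as the bottom cell of the next column to its right. For a partition $\mu$ of $kn$, let $\mathrm{SSYT}(\mathrm{SH}(0),\mu)$ be the set of fillings of $\mathrm{SH}(0)$ by positive integers, weakly increasing along rows (left to right) and strictly increasing down columns, with exactly $\mu_i$ entries equal to $i$ for every $i$. For $T\in\mathrm{SSYT}(\mathrm{SH}(0),\mu)$ let $I_j=[c_{1,j},c_{k,j}]$, $1\le j\le n$,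 where $c_{1,j}$ and $c_{k,j}$ are the top and bottom entries of the $j$-th column of $T$. Decompose $I_1,\dots,I_n$ greedily from left to right: start with the span $[L,R]=I_1$; if the next interval $I_j$ meets the current span $[L,R]$, keep $I_j$ in the current segment and replace $[L,R]$ by the smallest interval containing both; otherwise start a new segment with $[L,R]=I_j$. Let $r_{\min}(T)$ be the number of segments obtained (for $n=0$ it is $0$). Then for every partition $\mu\vdash kn$, \[ \sum_{\nu\vdash n}[e_\nu]\,\mathrm{row}_k(e_\mu)\;t^{\ell(\nu)}=\sum_{T\in\mathrm{SSYT}(\mathrm{SH}(0),\mu)}t^{\,r_{\min}(T)} . \] Equivalently, for every $1\le r\le n$, \[ \sum_{\substack{\nu\vdash n\\ \ell(\nu)=r}}[e_\nu]\,\mathrm{row}_k(e_\mu)=\bigl|\{T\in\mathrm{SSYT}(\mathrm{SH}(0),\mu): r_{\min}(T)=r\}\bigr| . \] -/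

import Mathlib

namespace RowDivision

/-! ### Symmetric functions over `ℚ` in the variables `x₀, x₁, x₂, …`

Symmetric functions are represented as formal power series in countably many variables. -/

/-- The monomial symmetric function `m_s`, where `s` is the multiset of (positive) parts of a
partition: the sum of all monomials whose multiset of nonzero exponents is `s`. -/
noncomputable def monomialSymm (s : Multiset ℕ) : MvPowerSeries ℕ ℚ :=
  fun α : ℕ →₀ ℕ => if α.support.val.map α = s then 1 else 0

/-- The elementary symmetric function `e_r`: the sum of all squarefree monomials of degree `r`. -/
noncomputable def elemSymm (r : ℕ) : MvPowerSeries ℕ ℚ :=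
  open Classical in
  fun α : ℕ →₀ ℕ => if (∀ i, α i ≤ 1) ∧ α.support.card = r then 1 else 0

/-- `e_μ = e_{μ₁} e_{μ₂} ⋯` for a partition `μ`. -/
noncomputable def elemSymmPart {m : ℕ} (μ : m.Partition) : MvPowerSeries ℕ ℚ :=
  (μ.parts.map elemSymm).prod

/-- The partition division map `row_k`: the linear map sending `x^(kα)` to `x^α` and every
monomial having some exponent not divisible by `k` to `0`. For `k ≥ 1` it is determined on
symmetric functions by its values on the basis of monomial symmetric functions, which are
given in `rowMap_monomialSymm` and `rowMap_monomialSymm_of_not_dvd`. -/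
noncomputable def rowMap (k : ℕ) : MvPowerSeries ℕ ℚ →ₗ[ℚ] MvPowerSeries ℕ ℚ where
  toFun f := fun α : ℕ →₀ ℕ => f (k • α)
  map_add' _ _ := rfl
  map_smul' _ _ := rfl

theorem parts_smul {k : ℕ} (hk : 0 < k) (α : ℕ →₀ ℕ) :
    (k • α).support.val.map (k • α) = (α.support.val.map α).map (k * ·) := by
  have h : (k • α).support = α.support := by
    ext i
    simp [hk.ne']
  rw [h, Multiset.map_map]
  rfl

/-- `row_k (m_{k s}) = m_s`. -/
theorem rowMap_monomialSymm {k : ℕ} (hk : 0 < k) (s : Multiset ℕ) :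
    rowMap k (monomialSymm (s.map (k * ·))) = monomialSymm s := by
  funext α
  have hinj : Function.Injective (k * · : ℕ → ℕ) := fun a b h => Nat.eq_of_mul_eq_mul_left hk h
  show (if (k • α).support.val.map (k • α) = s.map (k * ·) then (1 : ℚ) else 0) =
    if α.support.val.map α = s then (1 : ℚ) else 0
  rw [parts_smul hk]
  simp only [(Multiset.map_injective hinj).eq_iff]

/-- `row_k (m_s) = 0` if some part of `s` is not divisible by `k`. -/
theorem rowMap_monomialSymm_of_not_dvd {k : ℕ} (hk : 0 < k) (s : Multiset ℕ)
    (hs : ¬ ∀ a ∈ s, k ∣ a) : rowMap k (monomialSymm s) = 0 := by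
  funext α
  show (if (k • α).support.val.map (k • α) = s then (1 : ℚ) else 0) = 0
  rw [parts_smul hk, if_neg]
  rintro rfl
  apply hs
  intro a ha
  obtain ⟨b, -, rfl⟩ := Multiset.mem_map.1 ha
  exact dvd_mul_right k b

/-! ### Ribbons and semistandard tableaux

Cells are pairs `(row, column)`, both counted from `0`, rows from top to bottom and columns from
left to right. -/

/-- The ribbon `SH(i)` for the parameters `n`, `k` (`0 ≤ i < n`): it has `n - i` columns, of
lengths `k (i + 1), k, …, k` from left to right, and the top cell of each column lies in the same
row as the bottom cell of the next column to the right. -/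
def SH (n k i : ℕ) : Finset (ℕ × ℕ) :=
  (Finset.range (n - i)).biUnion fun j =>
    (Finset.range (if j = 0 then k * (i + 1) else k)).image fun a =>
      ((n - i - 1 - j) * (k - 1) + a, j)

/-- The `i`-th part (`i = 0` being the largest one) of a partition, `0` beyond its length. -/
def partAt {m : ℕ} (μ : m.Partition) (i : ℕ) : ℕ :=
  (μ.parts.sort (· ≥ ·)).getD i 0

/-- Semistandard tableaux of (skew) shape `D` and type `μ`: fillings of the cells of `D` by
positive integers, weakly increasing along rows and strictly increasing down columns, with
exactly `μ_i` entries equal to `i`. A filling is extended by `0` to the cells outside `D`. -/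
@[ext]
structure SSYT (D : Finset (ℕ × ℕ)) {m : ℕ} (μ : m.Partition) where
  entry : ℕ × ℕ → ℕ
  pos : ∀ c ∈ D, 0 < entry c
  row_weak : ∀ i j₁ j₂, (i, j₁) ∈ D → (i, j₂) ∈ D → j₁ < j₂ → entry (i, j₁) ≤ entry (i, j₂)
  col_strict : ∀ i₁ i₂ j, (i₁, j) ∈ D → (i₂, j) ∈ D → i₁ < i₂ → entry (i₁, j) < entry (i₂, j)
  content : ∀ v : ℕ, (D.filter fun c => entry c = v + 1).card = partAt μ v
  zeros : ∀ c, c ∉ D → entry c = 0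

theorem SSYT.entry_le {D : Finset (ℕ × ℕ)} {m : ℕ} {μ : m.Partition} (T : SSYT D μ)
    (c : ℕ × ℕ) : T.entry c < (μ.parts.sort (· ≥ ·)).length + 1 := by
  by_cases hc : c ∈ D
  · obtain ⟨v, hv⟩ := Nat.exists_eq_succ_of_ne_zero (T.pos c hc).ne'
    by_contra! hlt
    have h1 := T.content v
    have h0 : partAt μ v = 0 := List.getD_eq_default _ _ (by omega)
    rw [h0, Finset.card_eq_zero] at h1
    have : c ∈ D.filter fun c => T.entry c = v + 1 := Finset.mem_filter.2 ⟨hc, hv⟩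
    rw [h1] at this
    simp at this
  · rw [T.zeros c hc]
    omega

instance SSYT.instFinite (D : Finset (ℕ × ℕ)) {m : ℕ} (μ : m.Partition) : Finite (SSYT D μ) := by
  refine Finite.of_injective
    (fun (T : SSYT D μ) (c : D) =>
      (⟨T.entry c, T.entry_le c⟩ : Fin ((μ.parts.sort (· ≥ ·)).length + 1))) ?_
  intro T T' h
  apply SSYT.ext
  funext c
  by_cases hc : c ∈ D
  · exact congrArg Fin.val (congrFun h ⟨c, hc⟩)
  · rw [T.zeros c hc, T'.zeros c hc]

noncomputable instance SSYT.instFintype (D : Finset (ℕ × ℕ)) {m : ℕ} (μ : m.Partition) :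
    Fintype (SSYT D μ) := Fintype.ofFinite _

/-! ### Greedy decomposition of the extreme intervals -/

/-- The number of segments of the greedy decomposition when the current segment has span
`[L, R]` and the given intervals `[a, b]` remain to be processed. -/
def greedyFrom : ℕ → ℕ → List (ℕ × ℕ) → ℕ
  | _, _, [] => 1
  | L, R, (a, b) :: Is =>
    if (Finset.Icc a b ∩ Finset.Icc L R).Nonempty then greedyFrom (min L a) (max R b) Is
    else 1 + greedyFrom a b Is

/-- The number of segments of the greedy decomposition of a sequence of intervals. -/
def greedySegments : List (ℕ × ℕ) → ℕ
  | [] => 0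
  | (a, b) :: Is => greedyFrom a b Is

/-- The extreme interval of column `j` (`0 ≤ j < n`) of a tableau of shape `SH(0)`: its endpoints
are the top entry and the bottom entry of the column. -/
def extremeInterval {n k m : ℕ} {μ : m.Partition} (T : SSYT (SH n k 0) μ) (j : ℕ) : ℕ × ℕ :=
  (T.entry ((n - 1 - j) * (k - 1), j), T.entry ((n - 1 - j) * (k - 1) + (k - 1), j))

/-- The statistic `r_min`. -/
def rMin {n k m : ℕ} {μ : m.Partition} (T : SSYT (SH n k 0) μ) : ℕ :=
  greedySegments ((List.range n).map (extremeInterval T))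

end RowDivision

namespace RowDivision

open MvPowerSeries (coeff)
open scoped Polynomial

/-! The plan is to evaluate one linear functional φ (`lengthFunctional`) on both sides of the
expansion of row_k(e_μ). With α running over compositions of b, put φ(f) = Σ_{a+b=n} (t-1)^a Σ_α
(-1)^{b-ℓ(α)} [x^{(a,α)}] f. Passing through row_k multiplies exponents by k, and counting 0-1
matrices by rows or by columns (`coeff_prod_elemSymm_comm`) exchanges [x^β] e_μ with [x^μ] e_β.
Hence φ(row_k(e_μ)) is the coefficient of x^μ in Σ_{a+b=n} (t-1)^a e_{ka} Σ_α (-1)^{b-ℓ(α)} e_{kα_1}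
e_{kα_2} ⋯.

Order the columns of length k by u < v when every entry of u is below every entry of v. Cutting
increasing sequences into blocks shows that e_{ka} enumerates chains of a columns (`chainSum_colLt`
in spirit, proved as `chainSum_colWt`). The engine is `sum_lrMax`, valid for any strict partial
order: merging a chain into a descent-free word is a bijection onto descent-free words with some
left-to-right maxima marked. So Σ_w (1+s)^{lrMax w} over descent-free words of length n is Σ s^a ·
chains_a · words_b. At s = -1 this gives the recurrence `wordSum_succ`, which identifies the
alternating sum over α with the descent-free words; at s = t-1 it gives Σ_w t^{lrMax w}.

Descent-free words of columns are exactly the tableaux of ribbon shape, and their left-to-right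
maxima start the greedy segments (`greedySegments_eq`), so φ(row_k(e_μ)) is the tableau side. For k
= 1 only one word has content ν, the sorted one, whence φ(e_ν) = t^{ℓ(ν)}
(`lengthFunctional_elemSymmPart`). Applying φ to the e-expansion finishes the argument. -/

/-! ### Left-to-right maxima and marked words -/

open Classical in
/-- The number of letters of a word which satisfy `q` and are larger than all earlier letters. -/
noncomputable def lrMax {P : Type*} (r : P → P → Prop) : (P → Prop) → List P → ℕ
  | _, [] => 0
  | q, x :: w => (if q x then 1 else 0) + lrMax r (fun z => q z ∧ r x z) w

/-- Words without descents. -/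
def NoDesc {P : Type*} (r : P → P → Prop) (w : List P) : Prop :=
  w.IsChain fun x y => ¬ r y x

/-- The words of length `m`. -/
noncomputable def words (P : Type*) [Finite P] (m : ℕ) : Finset (List P) :=
  (List.finite_length_eq P m).toFinset

@[simp]
theorem mem_words {P : Type*} [Finite P] {m : ℕ} {l : List P} : l ∈ words P m ↔ l.length = m := by
  simp [words]

theorem sum_words_zero {P A : Type*} [Finite P] [AddCommMonoid A] (f : List P → A) :
    ∑ l ∈ words P 0, f l = f [] := by
  have : words P 0 = {[]} := by ext; simp
  rw [this, Finset.sum_singleton]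

theorem sum_words_succ {P A : Type*} [Fintype P] [AddCommMonoid A] (m : ℕ) (f : List P → A) :
    ∑ l ∈ words P (m + 1), f l = ∑ x : P, ∑ l ∈ words P m, f (x :: l) := by
  rw [← Finset.sum_product']
  symm
  refine Finset.sum_bij (fun p _ => p.1 :: p.2) ?_ ?_ ?_ ?_
  · rintro ⟨x, l⟩ h
    simpa using h
  · rintro ⟨x, l⟩ _ ⟨y, l'⟩ _ h
    simpa using h
  · rintro (_ | ⟨x, l⟩) h
    · simp at h
    · exact ⟨(x, l), by simpa using h, rfl⟩
  · intros
    rfl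

theorem sum_words_add {P A : Type*} [Fintype P] [AddCommMonoid A] (a b : ℕ) (f : List P → A) :
    ∑ l ∈ words P (a + b), f l = ∑ u ∈ words P a, ∑ v ∈ words P b, f (u ++ v) := by
  induction a generalizing f with
  | zero => simp [sum_words_zero]
  | succ a ih =>
    rw [Nat.add_right_comm, sum_words_succ, sum_words_succ]
    exact Finset.sum_congr rfl fun x _ => ih _

/-- The marked letters are larger than all letters before them. -/
def Marked {P : Type*} (r : P → P → Prop) (l : List (P × Bool)) : Prop :=
  l.Pairwise fun p p' => p'.2 = true → r p.1 p'.1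

-- Each left-to-right maximum is freely marked (factor s) or left unmarked (factor 1), and no other
-- letter can be marked. The predicate q records the comparisons with letters already read, which
-- lets the induction peel off the first letter.
open Classical in
theorem sum_marked {P A : Type*} [Fintype P] [CommSemiring A] (r : P → P → Prop) (s : A) (m : ℕ)
    (q : P → Prop) (g : List P → A) :
    ∑ l ∈ words (P × Bool) m, (if (∀ p ∈ l, p.2 = true → q p.1) ∧ Marked r l then
      s ^ l.countP (·.2) * g (l.map Prod.fst) else 0) =
    ∑ w ∈ words P m, (1 + s) ^ lrMax r q w * g w := by
  induction m generalizing q g with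
  | zero => simp [sum_words_zero, lrMax, Marked]
  | succ m ih =>
    rw [sum_words_succ, sum_words_succ, Fintype.sum_prod_type]
    refine Finset.sum_congr rfl fun x _ => ?_
    have key := ih (fun z => q z ∧ r x z) (fun w => g (x :: w))
    have hcond : ∀ (b : Bool) (l : List (P × Bool)),
        ((∀ p ∈ (x, b) :: l, p.2 = true → q p.1) ∧ Marked r ((x, b) :: l)) ↔
          (b = true → q x) ∧ ((∀ p ∈ l, p.2 = true → q p.1 ∧ r x p.1) ∧ Marked r l) := by
      intro b l
      simp only [List.forall_mem_cons, Marked, List.pairwise_cons]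
      constructor
      · rintro ⟨⟨h1, h2⟩, h3, h4⟩
        exact ⟨h1, fun p hp hb => ⟨h2 p hp hb, h3 p hp hb⟩, h4⟩
      · rintro ⟨h1, h2, h3⟩
        exact ⟨⟨h1, fun p hp hb => (h2 p hp hb).1⟩, fun p hp hb => (h2 p hp hb).2, h3⟩
    rw [Fintype.sum_bool]
    simp only [hcond, lrMax, List.map_cons, List.countP_cons]
    by_cases hq : q x
    · have e : ∀ l : List (P × Bool), s ^ (l.countP (·.2) + 1) * g (x :: l.map Prod.fst) =
          s * (s ^ l.countP (·.2) * g (x :: l.map Prod.fst)) := fun l => by ring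
      simp only [hq, implies_true, true_and, if_true, Bool.false_eq_true, if_false, Nat.add_zero, e]
      simp only [pow_add, pow_one, mul_assoc, add_mul, one_mul, Finset.sum_add_distrib]
      rw [← Finset.mul_sum, ← key, Finset.mul_sum, add_comm]
      simp only [mul_ite, mul_zero]
      congr!
    · simp [hq, ← key]

/-! ### Merging a chain into a word and splitting it off again -/

/-- Merging a chain (whose letters get marked) into a word. -/
noncomputable def mergeMarked {P : Type*} (r : P → P → Prop) :
    List P → List P → List (P × Bool)
  | [], w => w.map (·, false)
  | c :: C, [] => (c :: C).map (·, true)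
  | c :: C, x :: w =>
    open Classical in
    if r x c then (x, false) :: mergeMarked r (c :: C) w else (c, true) :: mergeMarked r C (x :: w)
termination_by C w => C.length + w.length

/-- The marked letters of a word. -/
def markedPart {P : Type*} (l : List (P × Bool)) : List P :=
  (l.filter (·.2)).map Prod.fst

/-- The unmarked letters of a word. -/
def unmarkedPart {P : Type*} (l : List (P × Bool)) : List P :=
  (l.filter (! ·.2)).map Prod.fst

@[simp] theorem markedPart_nil {P : Type*} : markedPart ([] : List (P × Bool)) = [] := rfl
@[simp] theorem unmarkedPart_nil {P : Type*} : unmarkedPart ([] : List (P × Bool)) = [] := rfl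
@[simp] theorem markedPart_cons_true {P : Type*} (x : P) (l : List (P × Bool)) :
    markedPart ((x, true) :: l) = x :: markedPart l := by simp [markedPart]
@[simp] theorem markedPart_cons_false {P : Type*} (x : P) (l : List (P × Bool)) :
    markedPart ((x, false) :: l) = markedPart l := by simp [markedPart]
@[simp] theorem unmarkedPart_cons_true {P : Type*} (x : P) (l : List (P × Bool)) :
    unmarkedPart ((x, true) :: l) = unmarkedPart l := by simp [unmarkedPart]
@[simp] theorem unmarkedPart_cons_false {P : Type*} (x : P) (l : List (P × Bool)) :
    unmarkedPart ((x, false) :: l) = x :: unmarkedPart l := by simp [unmarkedPart]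

theorem markedPart_mergeMarked {P : Type*} (r : P → P → Prop) (C w : List P) :
    markedPart (mergeMarked r C w) = C ∧ unmarkedPart (mergeMarked r C w) = w := by
  fun_induction mergeMarked r C w with
  | case1 w => simp [markedPart, unmarkedPart, List.filter_map, Function.comp_def]
  | case2 c C => simp [markedPart, unmarkedPart, List.filter_map, Function.comp_def]
  | case3 c C x w h ih => simp [ih]
  | case4 c C x w h ih => simp [ih]

theorem mem_mergeMarked {P : Type*} {r : P → P → Prop} {C w : List P} {x : P}
    (h : (x, true) ∈ mergeMarked r C w) : x ∈ C := by
  rw [← (markedPart_mergeMarked r C w).1]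
  simpa [markedPart] using h

theorem mergeMarked_nil_right {P : Type*} (r : P → P → Prop) (C : List P) :
    mergeMarked r C [] = C.map (·, true) := by
  cases C <;> simp [mergeMarked]

/-- A word letter is emitted before the current chain letter `c` only if it is below `c`, hence by
transitivity below the rest of the chain too. -/
theorem marked_mergeMarked {P : Type*} {r : P → P → Prop} [IsTrans P r] {C w : List P}
    (hC : C.Pairwise r) : Marked r (mergeMarked r C w) := by
  fun_induction mergeMarked r C w with
  | case1 w => simp [Marked, List.pairwise_map, List.pairwise_of_forall]
  | case2 c C => simpa [Marked, List.pairwise_map] using hC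
  | case3 c C x w h ih =>
    refine List.pairwise_cons.2 ⟨?_, ih hC⟩
    rintro ⟨y, b⟩ hy (rfl : b = true)
    rcases List.mem_cons.1 (mem_mergeMarked hy) with rfl | hy
    · exact h
    · exact _root_.trans h ((List.pairwise_cons.1 hC).1 y hy)
  | case4 c C x w h ih =>
    refine List.pairwise_cons.2 ⟨?_, ih (List.pairwise_cons.1 hC).2⟩
    rintro ⟨y, b⟩ hy (rfl : b = true)
    exact (List.pairwise_cons.1 hC).1 y (mem_mergeMarked hy)

theorem head?_mergeMarked {P : Type*} {r : P → P → Prop} {C w : List P} {y : P}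
    (h : y ∈ ((mergeMarked r C w).map Prod.fst).head?) : y ∈ C.head? ∨ y ∈ w.head? := by
  fun_induction mergeMarked r C w with
  | case1 w => right; simpa [Function.comp_def] using h
  | case2 c C => left; simpa using h
  | case3 c C x w _ ih => right; simpa using h
  | case4 c C x w _ ih => left; simpa using h

/-- At each switch between the two lists the merging rule itself forbids a descent: `x` precedes `c`
when `x` is below `c`, and `c` precedes `x` when `x` is not below `c`. -/
theorem noDesc_mergeMarked {P : Type*} {r : P → P → Prop} [IsTrans P r] [Std.Irrefl r]
    {C w : List P} (hC : C.Pairwise r) (hw : NoDesc r w) :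
    NoDesc r ((mergeMarked r C w).map Prod.fst) := by
  have asymm : ∀ {x y}, r x y → ¬ r y x := fun h h' => irrefl _ (_root_.trans h h')
  unfold NoDesc at hw ⊢
  fun_induction mergeMarked r C w with
  | case1 w => simpa [Function.comp_def] using hw
  | case2 c C =>
    simp only [List.map_map, Function.comp_def, List.map_id']
    exact (hC.imp fun h => asymm h).isChain
  | case3 c C x w h ih =>
    rw [List.isChain_cons] at hw
    refine List.isChain_cons.2 ⟨fun y hy => ?_, ih hC hw.2⟩
    rcases head?_mergeMarked hy with hy | hy
    · obtain rfl : c = y := by simpa using hy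
      exact asymm h
    · exact hw.1 y hy
  | case4 c C x w h ih =>
    refine List.isChain_cons.2 ⟨fun y hy => ?_, ih (List.pairwise_cons.1 hC).2 hw⟩
    rcases head?_mergeMarked hy with hy | hy
    · exact asymm ((List.pairwise_cons.1 hC).1 y (List.mem_of_mem_head? hy))
    · obtain rfl : x = y := by simpa using hy
      exact h

/-- Deleting marked letters creates no descent: an intervening marked letter lies above `x`, so a
later letter below `x` would be below that marked letter too, and the claim passes along the marked
run. This serves both the inverse of merging and the descent-freeness of the unmarked part. -/
theorem not_rel_head_unmarkedPart {P : Type*} {r : P → P → Prop} [IsTrans P r] {x : P} {b : Bool}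
    {l : List (P × Bool)} (hm : Marked r ((x, b) :: l))
    (hd : NoDesc r (((x, b) :: l).map Prod.fst)) : ∀ y ∈ (unmarkedPart l).head?, ¬ r y x := by
  induction l generalizing x b with
  | nil => simp
  | cons p l ih =>
    obtain ⟨z, b'⟩ := p
    have hm' := List.pairwise_cons.1 hm
    have hd' : ¬ r z x ∧ NoDesc r (((z, b') :: l).map Prod.fst) := by
      simpa [NoDesc, List.isChain_cons_cons] using hd
    cases b' with
    | false =>
      intro y hy
      obtain rfl : z = y := by simpa using hy
      exact hd'.1
    | true =>
      intro y hy hyx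
      exact ih hm'.2 hd'.2 y (by simpa using hy)
        (_root_.trans hyx (hm'.1 _ (List.mem_cons_self ..) rfl))

theorem mergeMarked_parts {P : Type*} {r : P → P → Prop} [IsTrans P r] {l : List (P × Bool)}
    (hm : Marked r l) (hd : NoDesc r (l.map Prod.fst)) :
    mergeMarked r (markedPart l) (unmarkedPart l) = l := by
  induction l with
  | nil => simp [mergeMarked]
  | cons p l ih =>
    obtain ⟨x, b⟩ := p
    have hm' := List.pairwise_cons.1 hm
    have ih' := ih hm'.2 (List.isChain_cons.1 hd).2
    have hhead := not_rel_head_unmarkedPart hm hd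
    cases b with
    | false =>
      rw [markedPart_cons_false, unmarkedPart_cons_false]
      generalize hC : markedPart l = C at *
      cases C with
      | nil => simpa [mergeMarked] using ih'
      | cons c C =>
        -- The next chain letter occurs later as a marked letter, so it exceeds `x`; this is the
        -- case in which merging emits `x` first.
        have hc : (c, true) ∈ l := by
          have : c ∈ markedPart l := by simp [hC]
          simpa [markedPart] using this
        rw [mergeMarked, if_pos (hm'.1 _ hc rfl), ih']
    | true =>
      rw [markedPart_cons_true, unmarkedPart_cons_true]
      generalize hw : unmarkedPart l = w at *
      cases w with
      | nil => rw [mergeMarked_nil_right] at ih' ⊢; simp [ih']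
      | cons y w => rw [mergeMarked, if_neg (hhead y (by simp)), ih']

theorem pairwise_markedPart {P : Type*} {r : P → P → Prop} {l : List (P × Bool)}
    (hm : Marked r l) : (markedPart l).Pairwise r := by
  rw [markedPart, List.pairwise_map]
  refine (List.Pairwise.filter _ hm).imp_of_mem fun _ hy h => h ?_
  simpa using (List.mem_filter.1 hy).2

theorem noDesc_unmarkedPart {P : Type*} {r : P → P → Prop} [IsTrans P r] {l : List (P × Bool)}
    (hm : Marked r l) (hd : NoDesc r (l.map Prod.fst)) : NoDesc r (unmarkedPart l) := by
  induction l with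
  | nil => simp [NoDesc]
  | cons p l ih =>
    obtain ⟨x, b⟩ := p
    have ih' := ih (List.pairwise_cons.1 hm).2 (List.isChain_cons.1 hd).2
    cases b with
    | true => simpa using ih'
    | false =>
      rw [unmarkedPart_cons_false]
      exact List.isChain_cons.2 ⟨not_rel_head_unmarkedPart hm hd, ih'⟩

/-! ### Generating functions of chains and of descent-free words -/

open Classical in
/-- The generating function of chains of length `a`. -/
noncomputable def chainSum {P A : Type*} [Fintype P] [CommSemiring A] (r : P → P → Prop) (wt : P → A)
    (a : ℕ) : A := ∑ C ∈ words P a with C.Pairwise r, (C.map wt).prod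

open Classical in
/-- The generating function of words of length `m` without descents. -/
noncomputable def wordSum {P A : Type*} [Fintype P] [CommSemiring A] (r : P → P → Prop) (wt : P → A)
    (m : ℕ) : A := ∑ w ∈ words P m with NoDesc r w, (w.map wt).prod

theorem prod_map_parts {P A : Type*} [CommSemiring A] (wt : P → A) (l : List (P × Bool)) :
    ((markedPart l).map wt).prod * ((unmarkedPart l).map wt).prod =
      ((l.map Prod.fst).map wt).prod := by
  induction l with
  | nil => simp
  | cons p l ih =>
    obtain ⟨x, _ | _⟩ := p
    · rw [markedPart_cons_false, unmarkedPart_cons_false, List.map_cons, List.map_cons, List.map_cons,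
        List.prod_cons, List.prod_cons, ← ih, mul_left_comm]
    · rw [markedPart_cons_true, unmarkedPart_cons_true, List.map_cons, List.map_cons, List.map_cons,
        List.prod_cons, List.prod_cons, ← ih, mul_assoc]

theorem length_markedPart {P : Type*} (l : List (P × Bool)) :
    (markedPart l).length = l.countP (·.2) := by
  simp [markedPart, List.countP_eq_length_filter]

theorem length_parts {P : Type*} (l : List (P × Bool)) :
    (markedPart l).length + (unmarkedPart l).length = l.length := by
  induction l with
  | nil => simp
  | cons p l ih =>
    obtain ⟨x, _ | _⟩ := p <;> simp [← ih] <;> omega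

open Classical in
theorem sum_lrMax {P A : Type*} [Fintype P] [CommSemiring A] (r : P → P → Prop) [IsTrans P r]
    [Std.Irrefl r] (wt : P → A) (s : A) (m : ℕ) :
    ∑ w ∈ words P m with NoDesc r w, (1 + s) ^ lrMax r (fun _ => True) w * (w.map wt).prod =
      ∑ ab ∈ Finset.HasAntidiagonal.antidiagonal m, s ^ ab.1 * (chainSum r wt ab.1 * wordSum r wt ab.2) := by
  have h := sum_marked r s m (fun _ => True) (fun w => if NoDesc r w then (w.map wt).prod else 0)
  simp only [mul_ite, mul_zero, ← Finset.sum_filter] at h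
  rw [← h]
  simp only [implies_true, true_and, Finset.filter_filter]
  have hprod : ∀ ab : ℕ × ℕ, s ^ ab.1 * (chainSum r wt ab.1 * wordSum r wt ab.2) =
      ∑ p ∈ {C ∈ words P ab.1 | C.Pairwise r} ×ˢ {w ∈ words P ab.2 | NoDesc r w},
        s ^ ab.1 * ((p.1.map wt).prod * (p.2.map wt).prod) := fun ab => by
    rw [chainSum, wordSum, Finset.sum_mul_sum, ← Finset.sum_product', Finset.mul_sum]
  simp only [hprod]
  rw [Finset.sum_sigma']
  refine Finset.sum_nbij'
    (fun l => ⟨((markedPart l).length, (unmarkedPart l).length), (markedPart l, unmarkedPart l)⟩)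
    (fun p => mergeMarked r p.2.1 p.2.2) ?_ ?_ ?_ ?_ ?_
  · intro l hl
    simp only [Finset.mem_filter, mem_words] at hl
    simp only [Finset.mem_sigma, Finset.HasAntidiagonal.mem_antidiagonal, Finset.mem_product, Finset.mem_filter,
      mem_words]
    exact ⟨(length_parts l).trans hl.1, ⟨trivial, pairwise_markedPart hl.2.1⟩,
      trivial, noDesc_unmarkedPart hl.2.1 hl.2.2⟩
  · rintro ⟨⟨a, b⟩, C, w⟩ h
    simp only [Finset.mem_sigma, Finset.HasAntidiagonal.mem_antidiagonal, Finset.mem_product, Finset.mem_filter,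
      mem_words] at h ⊢
    refine ⟨?_, marked_mergeMarked h.2.1.2, noDesc_mergeMarked h.2.1.2 h.2.2.2⟩
    rw [← length_parts, (markedPart_mergeMarked r C w).1, (markedPart_mergeMarked r C w).2, h.2.1.1,
      h.2.2.1, h.1]
  · intro l hl
    simp only [Finset.mem_filter, mem_words] at hl
    exact mergeMarked_parts hl.2.1 hl.2.2
  · rintro ⟨⟨a, b⟩, C, w⟩ h
    simp only [Finset.mem_sigma, Finset.HasAntidiagonal.mem_antidiagonal, Finset.mem_product, Finset.mem_filter,
      mem_words] at h
    obtain ⟨-, ⟨rfl, -⟩, rfl, -⟩ := h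
    simp only [(markedPart_mergeMarked r C w).1, (markedPart_mergeMarked r C w).2]
  · intro l hl
    simp only [length_markedPart, prod_map_parts]

theorem wordSum_zero {P A : Type*} [Fintype P] [CommSemiring A] (r : P → P → Prop) (wt : P → A) :
    wordSum r wt 0 = 1 := by
  rw [wordSum, Finset.sum_filter, sum_words_zero]
  simp [NoDesc]

theorem chainSum_zero {P A : Type*} [Fintype P] [CommSemiring A] (r : P → P → Prop) (wt : P → A) :
    chainSum r wt 0 = 1 := by
  rw [chainSum, Finset.sum_filter, sum_words_zero]
  simp

/-- This is `sum_lrMax` at s = -1: the first letter of a nonempty word is always a left-to-right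
maximum, so the left side vanishes. The term with an empty chain is then solved for. -/
theorem wordSum_succ {P A : Type*} [Fintype P] [CommRing A] (r : P → P → Prop) [IsTrans P r]
    [Std.Irrefl r] (wt : P → A) (m : ℕ) :
    wordSum r wt (m + 1) =
      ∑ i : Fin (m + 1), (-1) ^ (i : ℕ) * (chainSum r wt (i + 1) * wordSum r wt (m - i)) := by
  classical
  have h := sum_lrMax r wt (-1) (m + 1)
  rw [Finset.sum_eq_zero, Finset.Nat.sum_antidiagonal_eq_sum_range_succ_mk,
    Finset.sum_range_succ', ← Fin.sum_univ_eq_sum_range] at h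
  · simp only [pow_zero, chainSum_zero, one_mul, Nat.sub_zero, Nat.add_sub_add_right, pow_succ,
      mul_neg, mul_one, neg_mul, Finset.sum_neg_distrib] at h
    exact (neg_add_eq_zero.1 h.symm).symm
  · rintro (_ | ⟨x, w⟩) hw
    · simp at hw
    · simp [lrMax, pow_add]

open Classical in
theorem coeff_elemSymm (r : ℕ) (α : ℕ →₀ ℕ) :
    coeff α (elemSymm r) = if (∀ i, α i ≤ 1) ∧ α.support.card = r then 1 else 0 :=
  rfl

theorem elemSymm_zero : elemSymm 0 = 1 := by
  classical
  ext α
  rw [coeff_elemSymm, MvPowerSeries.coeff_one]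
  congr 1
  simp only [Finset.card_eq_zero, Finsupp.support_eq_empty, eq_iff_iff, and_iff_right_iff_imp]
  rintro rfl
  simp

/-! ### Transposing matrices of zeros and ones -/

/-- `l` is a matrix of zeros and ones with row sums `β` and column sums `α`. -/
structure IsZeroOneMatrix (α β : ℕ →₀ ℕ) (l : ℕ →₀ ℕ →₀ ℕ) : Prop where
  le_one : ∀ i j, l i j ≤ 1
  row : ∀ i, ∑ j ∈ α.support, l i j = β i
  col : ∀ j, ∑ i ∈ β.support, l i j = α j
  supp : ∀ i j, l i j ≠ 0 → i ∈ β.support ∧ j ∈ α.support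

/-- The transpose of a finitely supported matrix. -/
noncomputable def transpose (l : ℕ →₀ ℕ →₀ ℕ) : ℕ →₀ ℕ →₀ ℕ :=
  (Finsupp.equivMapDomain (Equiv.prodComm ℕ ℕ) l.uncurry).curry

theorem transpose_apply (l : ℕ →₀ ℕ →₀ ℕ) (i j : ℕ) : transpose l i j = l j i := by
  simp [transpose, Finsupp.equivMapDomain_apply]

theorem transpose_transpose (l : ℕ →₀ ℕ →₀ ℕ) : transpose (transpose l) = l := by
  ext i j
  simp [transpose_apply]

theorem IsZeroOneMatrix.transpose {α β : ℕ →₀ ℕ} {l : ℕ →₀ ℕ →₀ ℕ} (h : IsZeroOneMatrix α β l) :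
    IsZeroOneMatrix β α (transpose l) where
  le_one i j := by rw [transpose_apply]; exact h.le_one j i
  row i := by simp only [transpose_apply]; exact h.col i
  col j := by simp only [transpose_apply]; exact h.row j
  supp i j hij := by rw [transpose_apply] at hij; exact (h.supp j i hij).symm

theorem card_support_eq_sum {d : ℕ →₀ ℕ} {s : Finset ℕ} (hd : ∀ i, d i ≤ 1) (hs : d.support ⊆ s) :
    d.support.card = ∑ i ∈ s, d i := by
  rw [← Finset.sum_subset hs fun i _ hi => Finsupp.notMem_support_iff.1 hi, Finset.card_eq_sum_ones]
  refine Finset.sum_congr rfl fun i hi => ?_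
  have := hd i
  have := Finsupp.mem_support_iff.1 hi
  omega

theorem isZeroOneMatrix_iff (α β : ℕ →₀ ℕ) (l : ℕ →₀ ℕ →₀ ℕ) :
    IsZeroOneMatrix α β l ↔ l ∈ Finset.finsuppAntidiag β.support α ∧
      ∀ i ∈ β.support, (∀ j, l i j ≤ 1) ∧ (l i).support.card = β i := by
  rw [Finset.mem_finsuppAntidiag]
  constructor
  · intro h
    refine ⟨⟨?_, ?_⟩, fun i _ => ⟨h.le_one i, ?_⟩⟩
    · ext j
      rw [Finsupp.finsetSum_apply, h.col]
    · intro i hi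
      obtain ⟨j, hj⟩ := Finsupp.ne_iff.1 (Finsupp.mem_support_iff.1 hi)
      exact (h.supp i j hj).1
    · rw [← h.row, card_support_eq_sum (h.le_one i)]
      exact fun j hj => (h.supp i j (Finsupp.mem_support_iff.1 hj)).2
  · rintro ⟨⟨hsum, hsupp⟩, h⟩
    have hzero : ∀ i, i ∉ β.support → l i = 0 := fun i hi =>
      Finsupp.notMem_support_iff.1 fun h' => hi (hsupp h')
    have hcol : ∀ j, ∑ i ∈ β.support, l i j = α j := fun j => by
      rw [← hsum, Finsupp.finsetSum_apply]
    have hsupp' : ∀ i j, l i j ≠ 0 → i ∈ β.support ∧ j ∈ α.support := fun i j hij => by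
      have hi : i ∈ β.support := by
        by_contra hi
        exact hij (by simp [hzero i hi])
      refine ⟨hi, Finsupp.mem_support_iff.2 fun h0 => hij ?_⟩
      rw [← hcol, Finset.sum_eq_zero_iff] at h0
      exact h0 i hi
    have hle : ∀ i j, l i j ≤ 1 := fun i j => by
      by_cases hi : i ∈ β.support
      · exact (h i hi).1 j
      · simp [hzero i hi]
    refine ⟨hle, fun i => ?_, hcol, hsupp'⟩
    by_cases hi : i ∈ β.support
    · rw [← (h i hi).2, card_support_eq_sum (hle i)]
      exact fun j hj => (hsupp' i j (Finsupp.mem_support_iff.1 hj)).2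
    · rw [hzero i hi, Finsupp.notMem_support_iff.1 hi]
      simp

open Classical in
theorem coeff_prod_elemSymm (α β : ℕ →₀ ℕ) :
    coeff α (∏ i ∈ β.support, elemSymm (β i)) =
      ∑ l ∈ Finset.finsuppAntidiag β.support α, if IsZeroOneMatrix α β l then 1 else 0 := by
  rw [MvPowerSeries.coeff_prod]
  refine Finset.sum_congr rfl fun l hl => ?_
  simp only [coeff_elemSymm, isZeroOneMatrix_iff, hl, true_and]
  rw [Finset.prod_ite_zero]
  simp

/-- The number of matrices of zeros and ones with given row and column sums is invariant under
transposition. -/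
theorem coeff_prod_elemSymm_comm (α β : ℕ →₀ ℕ) :
    coeff α (∏ i ∈ β.support, elemSymm (β i)) = coeff β (∏ j ∈ α.support, elemSymm (α j)) := by
  classical
  rw [coeff_prod_elemSymm, coeff_prod_elemSymm, ← Finset.sum_filter, ← Finset.sum_filter]
  refine Finset.sum_nbij' transpose transpose ?_ ?_ (fun l _ => transpose_transpose l)
    (fun l _ => transpose_transpose l) (fun _ _ => rfl)
  · intro l hl
    have h := (Finset.mem_filter.1 hl).2.transpose
    exact Finset.mem_filter.2 ⟨((isZeroOneMatrix_iff _ _ _).1 h).1, h⟩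
  · intro l hl
    have h := (Finset.mem_filter.1 hl).2.transpose
    exact Finset.mem_filter.2 ⟨((isZeroOneMatrix_iff _ _ _).1 h).1, h⟩

/-! ### Exponents given by lists -/

theorem prod_range_getD {M : Type*} [CommMonoid M] (f : ℕ → M) (l : List ℕ) :
    ∏ i ∈ Finset.range l.length, f (l.getD i 0) = (l.map f).prod := by
  induction l with
  | nil => simp
  | cons a l ih => simp [Finset.prod_range_succ', ← ih, mul_comm]

/-- The condition `f 0 = 1` makes zero entries harmless; they do occur, since the first entry `a` of
the lists in `lengthFunctional` may be 0. -/
theorem prod_toFinsupp {M : Type*} [CommMonoid M] {f : ℕ → M} (hf : f 0 = 1) (l : List ℕ) :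
    ∏ i ∈ l.toFinsupp.support, f (l.toFinsupp i) = (l.map f).prod := by
  rw [← prod_range_getD, Finset.prod_subset l.toFinsupp_support_subset]
  · rfl
  · intro i _ hi
    rw [Finsupp.notMem_support_iff.1 hi, hf]

/-- The exponent whose `i`-th entry is the `i`-th part of a partition. -/
noncomputable def partExp {m : ℕ} (μ : m.Partition) : ℕ →₀ ℕ :=
  (μ.parts.sort (· ≥ ·)).toFinsupp

theorem partExp_apply {m : ℕ} (μ : m.Partition) (i : ℕ) : partExp μ i = partAt μ i := rfl

theorem support_partExp {m : ℕ} (μ : m.Partition) :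
    (partExp μ).support = Finset.range μ.parts.card := by
  rw [partExp, List.toFinsupp_support, Multiset.length_sort, Finset.filter_eq_self]
  intro i hi
  have hi' : i < (μ.parts.sort (· ≥ ·)).length := by simpa using hi
  rw [List.getD_eq_getElem _ _ hi']
  exact (μ.parts_pos ((Multiset.mem_sort _).1 (List.getElem_mem hi'))).ne'

theorem map_partExp {m : ℕ} (μ : m.Partition) :
    (partExp μ).support.val.map (partExp μ) = μ.parts := by
  rw [support_partExp]
  conv_rhs => rw [← Multiset.sort_eq μ.parts (· ≥ ·)]
  rw [Finset.range_val, Multiset.range, Multiset.map_coe]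
  congr 1
  refine List.ext_getElem (by simp) fun i h1 h2 => ?_
  simp only [List.getElem_map, List.getElem_range]
  exact List.getD_eq_getElem _ _ h2

theorem elemSymmPart_eq_prod {m : ℕ} (μ : m.Partition) :
    elemSymmPart μ = ∏ i ∈ (partExp μ).support, elemSymm (partExp μ i) := by
  rw [elemSymmPart]
  conv_lhs => rw [← map_partExp μ, Multiset.map_map]
  rfl

theorem coeff_elemSymmPart {m : ℕ} (μ : m.Partition) (α : ℕ →₀ ℕ) :
    coeff α (elemSymmPart μ) =
      coeff (partExp μ) ((α.support.val.map α).map elemSymm).prod := by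
  rw [elemSymmPart_eq_prod, coeff_prod_elemSymm_comm, Multiset.map_map]
  rfl

theorem coeff_toFinsupp_elemSymmPart {m : ℕ} (μ : m.Partition) (l : List ℕ) :
    coeff l.toFinsupp (elemSymmPart μ) = coeff (partExp μ) (l.map elemSymm).prod := by
  rw [elemSymmPart_eq_prod, coeff_prod_elemSymm_comm, prod_toFinsupp elemSymm_zero]

/-! ### Restriction to finitely many variables -/

theorem coeff_esymm (r a : ℕ) (d : Fin r →₀ ℕ) :
    (MvPolynomial.esymm (Fin r) ℚ a).coeff d =
      if (∀ i, d i ≤ 1) ∧ d.support.card = a then 1 else 0 := by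
  classical
  have key : ∀ t : Finset (Fin r), (∑ i ∈ t, Finsupp.single i 1 = d) ↔
      (∀ i, d i ≤ 1) ∧ d.support = t := by
    intro t
    have happ : ∀ j, (∑ i ∈ t, Finsupp.single i 1 : Fin r →₀ ℕ) j = if j ∈ t then 1 else 0 := by
      intro j
      simp [Finsupp.finsetSum_apply, Finsupp.single_apply]
    constructor
    · rintro rfl
      refine ⟨fun i => ?_, ?_⟩
      · rw [happ]; split_ifs <;> simp
      · ext j
        rw [Finsupp.mem_support_iff, happ]; simp
    · rintro ⟨h1, rfl⟩
      ext j
      rw [happ]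
      have := h1 j
      split_ifs with h
      · have := Finsupp.mem_support_iff.1 h
        omega
      · exact (Finsupp.notMem_support_iff.1 h).symm
  rw [MvPolynomial.esymm_eq_sum_monomial, MvPolynomial.coeff_sum]
  simp only [MvPolynomial.coeff_monomial, key]
  by_cases h1 : ∀ i, d i ≤ 1
  · simp [h1, Finset.mem_powersetCard]
  · simp [h1]

theorem killCompl_elemSymm (r a : ℕ) :
    MvPowerSeries.killCompl Fin.valEmbedding (elemSymm a) =
      ((MvPolynomial.esymm (Fin r) ℚ a : MvPolynomial (Fin r) ℚ) : MvPowerSeries (Fin r) ℚ) := by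
  classical
  ext d
  rw [MvPowerSeries.coeff_killCompl, MvPolynomial.coeff_coe, coeff_esymm, coeff_elemSymm,
    Finsupp.support_embDomain, Finset.card_map]
  congr 2
  rw [eq_iff_iff]
  constructor
  · intro h i
    have := h (Fin.valEmbedding i)
    rwa [Finsupp.embDomain_apply_self] at this
  · intro h i
    by_cases hi : i ∈ Set.range (Fin.valEmbedding (n := r))
    · obtain ⟨j, rfl⟩ := hi
      rw [Finsupp.embDomain_apply_self]
      exact h j
    · rw [Finsupp.embDomain_of_notMem_range _ _ _ hi]
      simp

theorem killCompl_prod_elemSymm (r : ℕ) (s : Multiset ℕ) :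
    MvPowerSeries.killCompl Fin.valEmbedding (s.map elemSymm).prod =
      (((s.map (MvPolynomial.esymm (Fin r) ℚ)).prod : MvPolynomial (Fin r) ℚ) :
        MvPowerSeries (Fin r) ℚ) := by
  rw [map_multiset_prod, Multiset.map_map, ← MvPolynomial.coeToMvPowerSeries.ringHom_apply,
    map_multiset_prod, Multiset.map_map]
  congr 1
  exact Multiset.map_congr rfl fun a _ => killCompl_elemSymm r a

theorem coeff_embDomain_prod (r : ℕ) (s : Multiset ℕ) (d : Fin r →₀ ℕ) :
    coeff (d.embDomain Fin.valEmbedding) (s.map elemSymm).prod =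
      (s.map (MvPolynomial.esymm (Fin r) ℚ)).prod.coeff d := by
  rw [← MvPowerSeries.coeff_killCompl, killCompl_prod_elemSymm, MvPolynomial.coeff_coe]

/-! ### The elementary basis -/

theorem degree_of_coeff_prod_ne_zero (s : Multiset ℕ) (α : ℕ →₀ ℕ)
    (h : coeff α (s.map elemSymm).prod ≠ 0) : α.degree = s.sum := by
  classical
  induction s using Multiset.induction_on generalizing α with
  | empty =>
    rw [Multiset.map_zero, Multiset.prod_zero, MvPowerSeries.coeff_one] at h
    obtain rfl : α = 0 := by by_contra h'; simp [h'] at h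
    simp
  | cons a s ih =>
    rw [Multiset.map_cons, Multiset.prod_cons, MvPowerSeries.coeff_mul] at h
    obtain ⟨⟨β, γ⟩, hp, hne⟩ := Finset.exists_ne_zero_of_sum_ne_zero h
    rw [Finset.HasAntidiagonal.mem_antidiagonal] at hp
    obtain rfl : β + γ = α := hp
    rw [map_add, Multiset.sum_cons, ih γ (right_ne_zero_of_mul hne)]
    have hβ := left_ne_zero_of_mul hne
    rw [coeff_elemSymm] at hβ
    have hβ' : (∀ i, β i ≤ 1) ∧ β.support.card = a := by by_contra h'; simp [h'] at hβ
    rw [← hβ'.2, card_support_eq_sum hβ'.1 subset_rfl]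
    rfl

/-- Homogeneous symmetric functions of degree `n`. -/
def homogSymm (n : ℕ) : Submodule ℚ (MvPowerSeries ℕ ℚ) where
  carrier := {f | (∀ α β : ℕ →₀ ℕ, α.support.val.map α = β.support.val.map β →
    coeff α f = coeff β f) ∧ ∀ α : ℕ →₀ ℕ, α.degree ≠ n → coeff α f = 0}
  add_mem' := fun {f g} hf hg => ⟨fun α β h => by rw [map_add, map_add, hf.1 α β h, hg.1 α β h],
    fun α h => by rw [map_add, hf.2 α h, hg.2 α h, add_zero]⟩
  zero_mem' := ⟨fun _ _ _ => by simp, fun _ _ => by simp⟩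
  smul_mem' := fun c f hf => ⟨fun α β h => by rw [map_smul, map_smul, hf.1 α β h],
    fun α h => by rw [map_smul, hf.2 α h, smul_zero]⟩

theorem elemSymmPart_mem {n : ℕ} (ν : n.Partition) : elemSymmPart ν ∈ homogSymm n := by
  refine ⟨fun α β h => by rw [coeff_elemSymmPart, coeff_elemSymmPart, h], fun α h => ?_⟩
  by_contra h'
  exact h ((degree_of_coeff_prod_ne_zero _ _ h').trans ν.parts_sum)

theorem rowMap_elemSymmPart_mem {n k : ℕ} (hk : 0 < k) (μ : (k * n).Partition) :
    rowMap k (elemSymmPart μ) ∈ homogSymm n := by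
  have hc : ∀ α, coeff α (rowMap k (elemSymmPart μ)) = coeff (k • α) (elemSymmPart μ) :=
    fun _ => rfl
  refine ⟨fun α β h => ?_, fun α h => ?_⟩
  · rw [hc, hc]
    apply (elemSymmPart_mem μ).1
    rw [parts_smul hk, parts_smul hk, h]
  · rw [hc]
    apply (elemSymmPart_mem μ).2
    rw [map_nsmul, smul_eq_mul]
    exact fun h' => h (Nat.eq_of_mul_eq_mul_left hk h')

/-- Every exponent of degree n is a rearrangement of the exponent of a partition, so these
coefficients determine `f`. This bounds the dimension of `homogSymm n` by the number of partitions.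
-/
theorem eq_zero_of_coeff_partExp {n : ℕ} {f : MvPowerSeries ℕ ℚ} (hf : f ∈ homogSymm n)
    (h : ∀ ν : n.Partition, coeff (partExp ν) f = 0) : f = 0 := by
  ext α
  rw [MvPowerSeries.coeff_zero]
  by_cases hα : α.degree = n
  · let ν : n.Partition := ⟨α.support.val.map α, fun {i} hi => by
      obtain ⟨j, hj, rfl⟩ := Multiset.mem_map.1 hi
      exact Nat.pos_of_ne_zero (Finsupp.mem_support_iff.1 hj), hα⟩
    rw [← h ν]
    exact hf.1 _ _ (map_partExp ν).symm
  · exact hf.2 α hα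

theorem prod_esymm_eq_aeval {n : ℕ} (ν : n.Partition) :
    (ν.parts.map (MvPolynomial.esymm (Fin n) ℚ)).prod =
      MvPolynomial.aeval (fun i : Fin n => MvPolynomial.esymm (Fin n) ℚ (i + 1))
        (MvPolynomial.monomial
          (Finsupp.equivFunOnFinite.symm fun i : Fin n => ν.parts.count ((i : ℕ) + 1)) (1 : ℚ)) := by
  rw [MvPolynomial.aeval_monomial, map_one, one_mul, Finsupp.prod_fintype _ _ fun _ => pow_zero _]
  simp only [Finsupp.equivFunOnFinite_symm_apply_apply]
  rw [Fin.prod_univ_eq_prod_range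
    (fun i => MvPolynomial.esymm (Fin n) ℚ (i + 1) ^ ν.parts.count (i + 1)) n,
    Finset.prod_multiset_map_count, Finset.range_eq_Ico,
    Finset.prod_Ico_add' (fun i => MvPolynomial.esymm (Fin n) ℚ i ^ ν.parts.count i)]
  refine Finset.prod_subset ?_ ?_
  · intro i hi
    rw [Multiset.mem_toFinset] at hi
    have h1 := ν.parts_pos hi
    have h2 := Multiset.le_sum_of_mem hi
    rw [ν.parts_sum] at h2
    rw [Finset.mem_Ico]
    omega
  · intro i _ hi
    rw [Multiset.mem_toFinset] at hi
    rw [Multiset.count_eq_zero_of_notMem hi, pow_zero]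

/-- After restriction to n variables, the e_ν become distinct monomials in e_1, …, e_n, which are
algebraically independent. -/
theorem linearIndependent_elemSymmPart (n : ℕ) :
    LinearIndependent ℚ (fun ν : n.Partition => elemSymmPart ν) := by
  rw [Fintype.linearIndependent_iff]
  intro c hc
  let e : n.Partition → Fin n →₀ ℕ := fun ν =>
    Finsupp.equivFunOnFinite.symm fun i : Fin n => ν.parts.count ((i : ℕ) + 1)
  have he : Function.Injective e := by
    intro ν ν' h
    apply Nat.Partition.ext
    ext a
    by_cases ha : 1 ≤ a ∧ a ≤ n
    · have := DFunLike.congr_fun h ⟨a - 1, by omega⟩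
      simpa [e, Nat.sub_add_cancel ha.1] using this
    · have : ∀ ν : n.Partition, ν.parts.count a = 0 := fun ν => by
        refine Multiset.count_eq_zero_of_notMem fun hi => ha ⟨ν.parts_pos hi, ?_⟩
        exact (Multiset.le_sum_of_mem hi).trans ν.parts_sum.le
      rw [this, this]
  have h1 : ∑ ν, c ν • MvPolynomial.monomial (e ν) (1 : ℚ) = 0 := by
    apply MvPolynomial.esymmAlgHom_fin_injective ℚ (le_refl n)
    rw [map_zero, ← Subtype.coe_inj, MvPolynomial.esymmAlgHom_apply, map_sum]
    simp only [map_smul, e, ← prod_esymm_eq_aeval]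
    have h2 := congrArg (MvPowerSeries.killCompl (Fin.valEmbedding (n := n))) hc
    simp only [map_sum, map_smul, elemSymmPart, killCompl_prod_elemSymm, map_zero] at h2
    apply MvPolynomial.coe_injective
    ext d
    have h3 := congrArg (coeff d) h2
    simpa [MvPolynomial.coeff_sum] using h3
  intro ν
  have h2 := congrArg (MvPolynomial.coeff (e ν)) h1
  simpa [MvPolynomial.coeff_sum, MvPolynomial.coeff_monomial, he.eq_iff] using h2

theorem exists_elemSymmPart_expansion {n : ℕ} {f : MvPowerSeries ℕ ℚ} (hf : f ∈ homogSymm n) :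
    ∃ c : n.Partition → ℚ, f = ∑ ν, c ν • elemSymmPart ν := by
  let b : n.Partition → homogSymm n := fun ν => ⟨elemSymmPart ν, elemSymmPart_mem ν⟩
  have hb : LinearIndependent ℚ b :=
    LinearIndependent.of_comp (homogSymm n).subtype (linearIndependent_elemSymmPart n)
  let E : homogSymm n →ₗ[ℚ] (n.Partition → ℚ) :=
    LinearMap.pi fun ν => (coeff (partExp ν)).comp (homogSymm n).subtype
  have hE : Function.Injective E := by
    rw [← LinearMap.ker_eq_bot, LinearMap.ker_eq_bot']
    intro g hg
    exact Subtype.ext (eq_zero_of_coeff_partExp g.2 fun ν => congrFun hg ν)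
  have : FiniteDimensional ℚ (homogSymm n) := FiniteDimensional.of_injective E hE
  -- Independence of the e_ν bounds the dimension below and injectivity of `E` bounds it above, so
  -- the e_ν span.
  have hcard : Fintype.card n.Partition = Module.finrank ℚ (homogSymm n) := by
    apply le_antisymm hb.fintype_card_le_finrank
    simpa using LinearMap.finrank_le_finrank_of_injective hE
  have hspan := hb.span_eq_top_of_card_eq_finrank' hcard
  have hmem : (⟨f, hf⟩ : homogSymm n) ∈ Submodule.span ℚ (Set.range b) := by
    rw [hspan]; trivial
  obtain ⟨c, hc⟩ := (Submodule.mem_span_range_iff_exists_fun ℚ).1 hmem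
  refine ⟨c, ?_⟩
  have := congrArg Subtype.val hc
  simpa [b] using this.symm

/-! ### Columns -/

/-- The strictly increasing words of length `k` with letters in `Fin r`. -/
noncomputable def sortedWords (k r : ℕ) : Finset (List (Fin r)) :=
  {l ∈ words (Fin r) k | l.Pairwise (· < ·)}

theorem mem_sortedWords {k r : ℕ} {l : List (Fin r)} :
    l ∈ sortedWords k r ↔ l.length = k ∧ l.Pairwise (· < ·) := by
  simp [sortedWords]

/-- The possible columns of length `k` with entries in `Fin r`. -/
abbrev Col (k r : ℕ) : Type := {l : List (Fin r) // l ∈ sortedWords k r}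

/-- All entries of `u` are smaller than all entries of `v`. -/
def colLt {k r : ℕ} (u v : Col k r) : Prop := ∀ x ∈ u.1, ∀ y ∈ v.1, x < y

theorem Col.length_eq {k r : ℕ} (u : Col k r) : u.1.length = k := (mem_sortedWords.1 u.2).1

theorem Col.sorted {k r : ℕ} (u : Col k r) : u.1.Pairwise (· < ·) := (mem_sortedWords.1 u.2).2

theorem Col.exists_mem {k r : ℕ} (hk : 0 < k) (u : Col k r) : ∃ x, x ∈ u.1 := by
  apply List.exists_mem_of_length_pos
  rw [u.length_eq]
  exact hk

theorem isTrans_colLt {k : ℕ} (hk : 0 < k) (r : ℕ) : IsTrans (Col k r) colLt :=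
  ⟨fun u v w h h' x hx z hz => by
    obtain ⟨y, hy⟩ := v.exists_mem hk
    exact (h x hx y hy).trans (h' y hy z hz)⟩

theorem irrefl_colLt {k : ℕ} (hk : 0 < k) (r : ℕ) : Std.Irrefl (colLt (k := k) (r := r)) :=
  ⟨fun u h => by
    obtain ⟨y, hy⟩ := u.exists_mem hk
    exact lt_irrefl y (h y hy y hy)⟩

/-- The concatenation of the columns of a word. -/
def entries {k r : ℕ} (w : List (Col k r)) : List (Fin r) := (w.map Subtype.val).flatten

@[simp] theorem entries_nil {k r : ℕ} : entries ([] : List (Col k r)) = [] := rfl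
@[simp] theorem entries_cons {k r : ℕ} (u : Col k r) (w : List (Col k r)) :
    entries (u :: w) = u.1 ++ entries w := rfl

theorem mem_entries {k r : ℕ} {w : List (Col k r)} {x : Fin r} :
    x ∈ entries w ↔ ∃ u ∈ w, x ∈ u.1 := by
  simp [entries]

-- Cutting a strictly increasing word of length ka into consecutive blocks of length k gives a chain
-- of a columns, and concatenation inverts this.
open Classical in
theorem sum_sortedWords_mul {A : Type*} [AddCommMonoid A] (k a r : ℕ) (g : List (Fin r) → A) :
    ∑ v ∈ sortedWords (k * a) r, g v =
      ∑ C ∈ words (Col k r) a with C.Pairwise colLt, g (entries C) := by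
  induction a generalizing g with
  | zero => simp [sortedWords, Finset.sum_filter, sum_words_zero]
  | succ a ih =>
    have h1 : ∑ v ∈ sortedWords (k * (a + 1)) r, g v = ∑ u ∈ sortedWords k r,
        ∑ v ∈ sortedWords (k * a) r, if ∀ x ∈ u, ∀ y ∈ v, x < y then g (u ++ v) else 0 := by
      rw [sortedWords, Finset.sum_filter, mul_add_one, add_comm, sum_words_add, sortedWords,
        Finset.sum_filter]
      refine Finset.sum_congr rfl fun u _ => ?_
      simp only [List.pairwise_append]
      split_ifs with hu
      · rw [sortedWords, Finset.sum_filter]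
        simp only [hu, true_and, ite_and]
      · simp [hu]
    rw [h1, ← Finset.sum_coe_sort (sortedWords k r), Finset.sum_filter, sum_words_succ]
    refine Finset.sum_congr rfl fun u _ => ?_
    rw [ih, Finset.sum_filter]
    refine Finset.sum_congr rfl fun C _ => ?_
    rw [← ite_and, entries_cons]
    congr 1
    rw [List.pairwise_cons, and_comm, eq_iff_iff]
    refine and_congr_left fun _ => ?_
    constructor
    · exact fun h v hv x hx y hy => h x hx y (mem_entries.2 ⟨v, hv, hy⟩)
    · intro h x hx y hy
      obtain ⟨v, hv, hy⟩ := mem_entries.1 hy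
      exact h v hv x hx y hy

theorem sum_sortedWords_prod (A : Type*) [CommSemiring A] (m r : ℕ) :
    ∑ v ∈ sortedWords m r, (v.map MvPolynomial.X).prod = MvPolynomial.esymm (Fin r) A m := by
  rw [MvPolynomial.esymm]
  refine Finset.sum_bij' (fun l _ => l.toFinset) (fun t _ => t.sort (· ≤ ·)) ?_ ?_ ?_ ?_ ?_
  · intro l hl
    obtain ⟨h1, h2⟩ := mem_sortedWords.1 hl
    rw [Finset.mem_powersetCard_univ, List.toFinset_card_of_nodup (h2.imp fun h => h.ne), h1]
  · intro t ht
    rw [mem_sortedWords, Finset.length_sort]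
    exact ⟨Finset.mem_powersetCard_univ.1 ht, (Finset.sortedLT_sort t).pairwise⟩
  · intro l hl
    obtain ⟨h1, h2⟩ := mem_sortedWords.1 hl
    exact (List.toFinset_sort (· ≤ ·) (h2.imp fun h => h.ne)).2 (h2.imp fun h => h.le)
  · intro t _
    simp
  · intro l hl
    exact (List.prod_toFinset _ ((mem_sortedWords.1 hl).2.imp fun h => h.ne)).symm

/-- The monomial of a column. -/
noncomputable def colWt (A : Type*) [CommSemiring A] {k r : ℕ} (u : Col k r) :
    MvPolynomial (Fin r) A := (u.1.map MvPolynomial.X).prod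

theorem prod_colWt (A : Type*) [CommSemiring A] {k r : ℕ} (w : List (Col k r)) :
    (w.map (colWt A)).prod = ((entries w).map MvPolynomial.X).prod := by
  induction w with
  | nil => simp
  | cons u w ih =>
    rw [List.map_cons, List.prod_cons, ih, entries_cons, List.map_append, List.prod_append, colWt]

theorem chainSum_colWt (A : Type*) [CommSemiring A] (k a r : ℕ) :
    chainSum (colLt (k := k) (r := r)) (colWt A) a = MvPolynomial.esymm (Fin r) A (k * a) := by
  classical
  rw [← sum_sortedWords_prod, sum_sortedWords_mul, chainSum]
  simp only [prod_colWt]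

theorem coeff_prod_X (A : Type*) [CommSemiring A] {r : ℕ} (l : List (Fin r)) (d : Fin r →₀ ℕ) :
    ((l.map MvPolynomial.X).prod : MvPolynomial (Fin r) A).coeff d =
      if ∀ i, l.count i = d i then 1 else 0 := by
  have h : ((l.map MvPolynomial.X).prod : MvPolynomial (Fin r) A) =
      MvPolynomial.monomial (Finsupp.equivFunOnFinite.symm fun i => l.count i) 1 := by
    induction l with
    | nil =>
      have h0 : (Finsupp.equivFunOnFinite.symm fun i => ([] : List (Fin r)).count i) = 0 := by
        ext i
        rfl
      rw [h0]
      rfl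
    | cons x l ih =>
      rw [List.map_cons, List.prod_cons, ih, MvPolynomial.X, MvPolynomial.monomial_mul, one_mul]
      congr 2
      ext i
      simp [List.count_cons, Finsupp.single_apply, add_comm]
  classical
  rw [h, MvPolynomial.coeff_monomial]
  congr 1
  rw [Finsupp.ext_iff]
  rfl

/-! ### Alternating sums over compositions -/

/-- The sum of `(-1) ^ (m - ℓ(α)) g(α)` over the compositions `α` of `m`. -/
def compSum {M : Type*} [AddCommGroup M] : ℕ → (List ℕ → M) → M
  | 0, g => g []
  | m + 1, g => ∑ i : Fin (m + 1), (-1 : ℤ) ^ (i : ℕ) • compSum (m - i) fun l => g ((i + 1) :: l)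
termination_by m => m

theorem compSum_add {M : Type*} [AddCommGroup M] (m : ℕ) (g h : List ℕ → M) :
    compSum m (fun l => g l + h l) = compSum m g + compSum m h := by
  induction m using Nat.strong_induction_on generalizing g h with
  | _ m ih =>
    cases m with
    | zero => simp [compSum]
    | succ m =>
      rw [compSum, compSum, compSum, ← Finset.sum_add_distrib]
      refine Finset.sum_congr rfl fun i _ => ?_
      rw [ih _ (by omega), smul_add]

theorem compSum_smul {S M : Type*} [CommRing S] [AddCommGroup M] [Module S M] (m : ℕ) (c : S)
    (g : List ℕ → M) : compSum m (fun l => c • g l) = c • compSum m g := by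
  induction m using Nat.strong_induction_on generalizing g with
  | _ m ih =>
    cases m with
    | zero => simp [compSum]
    | succ m =>
      rw [compSum, compSum, Finset.smul_sum]
      refine Finset.sum_congr rfl fun i _ => ?_
      rw [ih _ (by omega), smul_comm]

/-- Unrolling the recurrence for `R` produces one signed product of the `c`'s for each composition.
The prefactor `p` absorbs the parts already chosen, and `L` is later a coefficient extraction. -/
theorem compSum_eq {A M : Type*} [CommRing A] [AddCommGroup M] (L : A →+ M) (c R : ℕ → A)
    (h0 : R 0 = 1)
    (hR : ∀ m, R (m + 1) = ∑ i : Fin (m + 1), (-1) ^ (i : ℕ) * (c (i + 1) * R (m - i))) (m : ℕ)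
    (p : A) : compSum m (fun l => L (p * (l.map c).prod)) = L (p * R m) := by
  induction m using Nat.strong_induction_on generalizing p with
  | _ m ih =>
    cases m with
    | zero => simp [compSum, h0]
    | succ m =>
      rw [compSum, hR, Finset.mul_sum, map_sum]
      refine Finset.sum_congr rfl fun i _ => ?_
      have h := ih (m - i) (by omega) (p * c (i + 1))
      simp only [List.map_cons, List.prod_cons, ← mul_assoc] at h ⊢
      rw [h, ← map_zsmul, zsmul_eq_mul]
      push_cast
      congr 1
      ring

/-- A linear functional sending `e_ν` to `t ^ ℓ(ν)` for all partitions `ν` of `n`. -/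
noncomputable def lengthFunctional (n : ℕ) : MvPowerSeries ℕ ℚ →ₗ[ℚ] ℚ[X] where
  toFun f := ∑ ab ∈ Finset.HasAntidiagonal.antidiagonal n, (Polynomial.X - 1) ^ ab.1 *
    compSum ab.2 fun l => Polynomial.C (coeff (ab.1 :: l).toFinsupp f)
  map_add' f g := by
    simp only [map_add, compSum_add, mul_add, Finset.sum_add_distrib]
  map_smul' c f := by
    simp only [map_smul, smul_eq_mul, map_mul, RingHom.id_apply, Finset.smul_sum]
    refine Finset.sum_congr rfl fun ab _ => ?_
    simp only [← Polynomial.smul_eq_C_mul]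
    rw [compSum_smul, mul_smul_comm]

theorem coeff_toFinsupp_rowMap (k : ℕ) (f : MvPowerSeries ℕ ℚ) (l : List ℕ) :
    coeff l.toFinsupp (rowMap k f) = coeff (l.map (k * ·)).toFinsupp f := by
  have h : k • l.toFinsupp = (l.map (k * ·)).toFinsupp := by
    ext i
    rw [Finsupp.smul_apply, List.toFinsupp_apply, List.toFinsupp_apply]
    by_cases hi : i < l.length
    · rw [List.getD_eq_getElem _ _ hi, List.getD_eq_getElem _ _ (by simpa using hi)]
      simp
    · rw [List.getD_eq_default _ _ (by omega), List.getD_eq_default _ _ (by simpa using hi)]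
      simp
  rw [← h]
  rfl

/-- The parts of a partition, indexed by `Fin`. -/
noncomputable def partExpFin {m : ℕ} (μ : m.Partition) : Fin μ.parts.card →₀ ℕ :=
  Finsupp.equivFunOnFinite.symm fun i => partAt μ i

theorem C_coeff_partExp {m : ℕ} (μ : m.Partition) (l : List ℕ) :
    Polynomial.C (coeff (partExp μ) (l.map elemSymm).prod) =
      ((l.map (MvPolynomial.esymm (Fin μ.parts.card) ℚ[X])).prod).coeff (partExpFin μ) := by
  have h : partExp μ = Finsupp.embDomain Fin.valEmbedding (partExpFin μ) := by
    ext i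
    by_cases hi : i < μ.parts.card
    · exact (Finsupp.embDomain_apply_self Fin.valEmbedding (partExpFin μ) (⟨i, hi⟩ : Fin μ.parts.card)).symm
    · rw [Finsupp.embDomain_of_notMem_range]
      · rw [← Finsupp.notMem_support_iff, support_partExp]
        simpa using hi
      · rintro ⟨j, rfl⟩
        exact hi j.2
  have h2 := coeff_embDomain_prod μ.parts.card (l : Multiset ℕ) (partExpFin μ)
  rw [Multiset.map_coe, Multiset.prod_coe, Multiset.map_coe, Multiset.prod_coe, ← h] at h2
  rw [h2, ← MvPolynomial.coeff_map, map_list_prod, List.map_map]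
  congr 2
  exact List.map_congr_left fun a _ => MvPolynomial.map_esymm _ _ _ _

open Classical in
theorem lengthFunctional_rowMap {k m : ℕ} (hk : 0 < k) (n : ℕ) (μ : m.Partition) :
    lengthFunctional n (rowMap k (elemSymmPart μ)) =
      ∑ w ∈ words (Col k μ.parts.card) n with
        NoDesc colLt w ∧ ∀ i, (entries w).count i = partAt μ i,
        Polynomial.X ^ lrMax colLt (fun _ => True) w := by
  have := isTrans_colLt hk μ.parts.card
  have := irrefl_colLt hk μ.parts.card
  let L : MvPolynomial (Fin μ.parts.card) ℚ[X] →ₗ[ℚ[X]] ℚ[X] :=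
    MvPolynomial.lcoeff ℚ[X] (partExpFin μ)
  have hL : ∀ p, L p = p.coeff (partExpFin μ) := fun _ => rfl
  clear_value L
  let wt : Col k μ.parts.card → MvPolynomial (Fin μ.parts.card) ℚ[X] := colWt ℚ[X]
  have h1 : ∀ a b, compSum b (fun l => Polynomial.C
      (coeff (a :: l).toFinsupp (rowMap k (elemSymmPart μ)))) =
      L (chainSum colLt wt a * wordSum colLt wt b) := by
    intro a b
    change _ = L.toAddMonoidHom _
    rw [← compSum_eq L.toAddMonoidHom (chainSum colLt wt)
      (wordSum colLt wt) (wordSum_zero _ _) (wordSum_succ _ _)]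
    congr 1
    funext l
    rw [coeff_toFinsupp_rowMap, coeff_toFinsupp_elemSymmPart, C_coeff_partExp]
    have hc : chainSum colLt wt = fun a => MvPolynomial.esymm _ _ (k * a) :=
      funext fun a => chainSum_colWt _ k a _
    rw [hc, List.map_map, List.map_cons, List.prod_cons]
    exact (hL _).symm
  -- The choice s = t - 1 turns the weight 1 + s of a left-to-right maximum into t.
  have h2 := congrArg L (sum_lrMax colLt wt (MvPolynomial.C (Polynomial.X - 1)) n)
  have h3 : lengthFunctional n (rowMap k (elemSymmPart μ)) =
      ∑ ab ∈ Finset.HasAntidiagonal.antidiagonal n, (Polynomial.X - 1) ^ ab.1 *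
        L (chainSum colLt wt ab.1 * wordSum colLt wt ab.2) :=
    by simp only [lengthFunctional, LinearMap.coe_mk, AddHom.coe_mk, h1]
  have hC : (1 : MvPolynomial (Fin μ.parts.card) ℚ[X]) + MvPolynomial.C (Polynomial.X - 1) =
      MvPolynomial.C Polynomial.X := by
    rw [← MvPolynomial.C_1, ← map_add]
    simp
  rw [map_sum, map_sum, hC] at h2
  simp only [← map_pow, ← MvPolynomial.smul_eq_C_mul, map_smul, smul_eq_mul] at h2
  rw [h3, ← h2]
  conv_rhs => rw [← Finset.filter_filter, Finset.sum_filter]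
  refine Finset.sum_congr rfl fun w _ => ?_
  have : L (w.map wt).prod = if ∀ i, (entries w).count i = partAt μ i then 1 else 0 := by
    rw [hL, prod_colWt, coeff_prod_X]
    rfl
  rw [this, mul_ite, mul_one, mul_zero]

/-! ### Columns of length one -/

/-- The column with a single entry. -/
noncomputable def singleCol {r : ℕ} (x : Fin r) : Col 1 r := ⟨[x], by simp [mem_sortedWords]⟩

theorem entries_map_singleCol {r : ℕ} (u : List (Fin r)) : entries (u.map singleCol) = u := by
  induction u with
  | nil => rfl
  | cons x u ih => rw [List.map_cons, entries_cons, ih]; rfl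

theorem map_singleCol_entries {r : ℕ} (w : List (Col 1 r)) : (entries w).map singleCol = w := by
  induction w with
  | nil => rfl
  | cons v w ih =>
    obtain ⟨x, hx⟩ := List.length_eq_one_iff.1 v.length_eq
    rw [entries_cons, List.map_append, ih, hx, List.map_singleton, List.singleton_append]
    congr 1
    exact Subtype.ext hx.symm

theorem colLt_singleCol {r : ℕ} (x y : Fin r) : colLt (singleCol x) (singleCol y) ↔ x < y := by
  simp [colLt, singleCol]

theorem noDesc_map_singleCol {r : ℕ} (u : List (Fin r)) :
    NoDesc colLt (u.map singleCol) ↔ u.Pairwise (· ≤ ·) := by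
  rw [NoDesc, List.isChain_map, ← List.isChain_iff_pairwise]
  simp only [colLt_singleCol, not_lt]

/-- In a weakly increasing word the left-to-right maxima are the first occurrences of values. Here
`b` is the last letter already read, so its further copies do not count. -/
theorem lrMax_map_singleCol_of_lt {r : ℕ} (u : List (Fin r)) (b : Fin r) (q : Col 1 r → Prop)
    (hq : ∀ z, q (singleCol z) ↔ b < z) (hu : (b :: u).Pairwise (· ≤ ·)) :
    lrMax colLt q (u.map singleCol) = (u.toFinset.erase b).card := by
  induction u generalizing b q with
  | nil => rfl
  | cons x u ih =>
    rw [List.pairwise_cons] at hu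
    have hbx : b ≤ x := hu.1 x (by simp)
    rw [List.map_cons, lrMax, ih x _ ?_ hu.2, hq, List.toFinset_cons]
    · rcases hbx.eq_or_lt with rfl | hlt
      · rw [if_neg (lt_irrefl b), zero_add, Finset.erase_insert_eq_erase]
      · have hb : b ∉ insert x u.toFinset := by
          have hxu := (List.pairwise_cons.1 hu.2).1
          rw [Finset.mem_insert, List.mem_toFinset]
          rintro (rfl | h)
          · exact lt_irrefl b hlt
          · exact (hlt.trans_le (hxu b h)).false
        rw [if_pos hlt, Finset.erase_eq_of_notMem hb,
          ← Finset.card_erase_add_one (Finset.mem_insert_self x _), Finset.erase_insert_eq_erase,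
          add_comm]
    · intro z
      rw [hq, colLt_singleCol]
      exact ⟨fun h => h.2, fun h => ⟨hbx.trans_lt h, h⟩⟩

theorem lrMax_map_singleCol {r : ℕ} (u : List (Fin r)) (hu : u.Pairwise (· ≤ ·)) :
    lrMax colLt (fun _ => True) (u.map singleCol) = u.toFinset.card := by
  cases u with
  | nil => rfl
  | cons x u =>
    rw [List.map_cons, lrMax, lrMax_map_singleCol_of_lt u x _ (by simp [colLt_singleCol]) hu,
      if_pos trivial, List.toFinset_cons, ← Finset.card_erase_add_one (Finset.mem_insert_self x _),
      Finset.erase_insert_eq_erase, add_comm]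

theorem partAt_pos {m : ℕ} (μ : m.Partition) {i : ℕ} (hi : i < μ.parts.card) : 0 < partAt μ i := by
  rw [← partExp_apply, Nat.pos_iff_ne_zero, ← Finsupp.mem_support_iff, support_partExp]
  simpa using hi

theorem sum_partAt {m : ℕ} (μ : m.Partition) : ∑ i : Fin μ.parts.card, partAt μ i = m := by
  rw [Fin.sum_univ_eq_sum_range (partAt μ), ← support_partExp]
  conv_rhs => rw [← μ.parts_sum, ← map_partExp μ]
  rfl

theorem rowMap_one (f : MvPowerSeries ℕ ℚ) : rowMap 1 f = f := by
  funext α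
  change f (1 • α) = f α
  rw [one_smul]

theorem lengthFunctional_elemSymmPart {n : ℕ} (ν : n.Partition) :
    lengthFunctional n (elemSymmPart ν) = Polynomial.X ^ ν.parts.card := by
  classical
  rw [← rowMap_one (elemSymmPart ν), lengthFunctional_rowMap one_pos]
  -- With k = 1, descent-free means weakly increasing, so sorting the multiset of content ν gives
  -- the only word; all ℓ(ν) values occur in it.
  let s : Multiset (Fin ν.parts.card) := ∑ i : Fin ν.parts.card, Multiset.replicate (partAt ν i) i
  have hs : ∀ i, s.count i = partAt ν i := fun i => by
    simp [s, Multiset.count_sum', Multiset.count_replicate]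
  have hcard : s.card = n := by
    simp [s, sum_partAt]
  have hsort : (s.sort (· ≤ ·)).Pairwise (· ≤ ·) := Multiset.pairwise_sort s (· ≤ ·)
  have hcount : ∀ i, (s.sort (· ≤ ·)).count i = partAt ν i := fun i => by
    rw [← hs, ← Multiset.coe_count, Multiset.sort_eq]
  have h : (words (Col 1 ν.parts.card) n).filter (fun w =>
      NoDesc colLt w ∧ ∀ i, (entries w).count i = partAt ν i) =
      {(s.sort (· ≤ ·)).map singleCol} := by
    ext w
    rw [Finset.mem_filter, mem_words, Finset.mem_singleton]
    constructor
    · rintro ⟨-, h1, h2⟩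
      rw [← map_singleCol_entries w] at h1 ⊢
      rw [noDesc_map_singleCol] at h1
      congr 1
      refine List.Perm.eq_of_pairwise' h1 hsort (List.perm_iff_count.2 fun i => ?_)
      rw [h2, hcount]
    · rintro rfl
      rw [noDesc_map_singleCol, entries_map_singleCol]
      exact ⟨by simp [hcard], hsort, hcount⟩
  rw [h, Finset.sum_singleton, lrMax_map_singleCol _ hsort]
  congr 1
  have : (s.sort (· ≤ ·)).toFinset = Finset.univ := by
    ext i
    rw [List.mem_toFinset, ← List.count_pos_iff, hcount]
    simpa using partAt_pos ν i.2
  rw [this, Finset.card_univ, Fintype.card_fin]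

/-! ### Tableaux of ribbon shape as words of columns -/

theorem mem_SH_zero {n k i j : ℕ} :
    (i, j) ∈ SH n k 0 ↔ j < n ∧ ∃ a < k, i = (n - 1 - j) * (k - 1) + a := by
  simp only [SH, Nat.sub_zero, zero_add, mul_one, ite_self, Finset.mem_biUnion, Finset.mem_range,
    Finset.mem_image, Prod.mk.injEq]
  constructor
  · rintro ⟨j', hj, a, ha, rfl, rfl⟩
    exact ⟨hj, a, ha, rfl⟩
  · rintro ⟨hj, a, ha, rfl⟩
    exact ⟨j, hj, a, ha, rfl, rfl⟩

theorem cell_mem_SH {n k j a : ℕ} (hj : j < n) (ha : a < k) :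
    ((n - 1 - j) * (k - 1) + a, j) ∈ SH n k 0 :=
  mem_SH_zero.2 ⟨hj, a, ha, rfl⟩

theorem sum_SH_zero {M : Type*} [AddCommMonoid M] (n k : ℕ) (f : ℕ × ℕ → M) :
    ∑ c ∈ SH n k 0, f c = ∑ j ∈ Finset.range n, ∑ a ∈ Finset.range k,
      f ((n - 1 - j) * (k - 1) + a, j) := by
  rw [← Finset.sum_product']
  symm
  refine Finset.sum_bij (fun p _ => ((n - 1 - p.1) * (k - 1) + p.2, p.1)) ?_ ?_ ?_ fun _ _ => rfl
  · rintro ⟨j, a⟩ h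
    simp only [Finset.mem_product, Finset.mem_range] at h
    exact cell_mem_SH h.1 h.2
  · rintro ⟨j, a⟩ _ ⟨j', a'⟩ _ h
    simp only [Prod.mk.injEq] at h
    obtain ⟨h, rfl⟩ := h
    simpa using h
  · rintro ⟨i, j⟩ h
    obtain ⟨hj, a, ha, rfl⟩ := mem_SH_zero.1 h
    exact ⟨(j, a), by simp [hj, ha], rfl⟩

/-- The `a`-th entry of a column. -/
def Col.entry {k r : ℕ} (u : Col k r) (a : ℕ) : ℕ := (u.1.map Fin.val).getD a 0

theorem Col.entry_eq {k r : ℕ} (u : Col k r) {a : ℕ} (ha : a < k) :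
    u.entry a = (u.1[a]'(by rw [u.length_eq]; exact ha)).val := by
  rw [Col.entry, List.getD_eq_getElem _ _ (by simpa [u.length_eq] using ha), List.getElem_map]

theorem Col.entry_lt {k r : ℕ} (u : Col k r) {a : ℕ} (ha : a < k) : u.entry a < r := by
  rw [u.entry_eq ha]
  exact Fin.is_lt _

theorem Col.ext_entry {k r : ℕ} {u v : Col k r} (h : ∀ a < k, u.entry a = v.entry a) : u = v := by
  refine Subtype.ext (List.ext_getElem (by rw [u.length_eq, v.length_eq]) fun a h1 h2 => ?_)
  have ha : a < k := by rwa [u.length_eq] at h1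
  have := h a ha
  rw [u.entry_eq ha, v.entry_eq ha] at this
  exact Fin.ext this

theorem Col.entry_lt_entry {k r : ℕ} (u : Col k r) {a b : ℕ} (hab : a < b) (hb : b < k) :
    u.entry a < u.entry b := by
  rw [u.entry_eq (hab.trans hb), u.entry_eq hb]
  exact List.pairwise_iff_getElem.1 u.sorted a b _ _ hab

theorem Col.entry_le_entry {k r : ℕ} (u : Col k r) {a b : ℕ} (hab : a ≤ b) (hb : b < k) :
    u.entry a ≤ u.entry b := by
  rcases hab.eq_or_lt with rfl | h
  · rfl
  · exact (u.entry_lt_entry h hb).le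

theorem Col.mem_iff {k r : ℕ} (u : Col k r) (x : Fin r) :
    x ∈ u.1 ↔ ∃ a < k, u.entry a = x := by
  rw [List.mem_iff_getElem]
  constructor
  · rintro ⟨a, ha, rfl⟩
    rw [u.length_eq] at ha
    exact ⟨a, ha, u.entry_eq ha⟩
  · rintro ⟨a, ha, h⟩
    rw [u.entry_eq ha] at h
    exact ⟨a, by rwa [u.length_eq], Fin.ext h⟩

theorem colLt_iff {k r : ℕ} (hk : 0 < k) (u v : Col k r) :
    colLt u v ↔ u.entry (k - 1) < v.entry 0 := by
  have hk' : k - 1 < k := by omega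
  constructor
  · intro h
    exact h ⟨u.entry (k - 1), u.entry_lt hk'⟩ ((u.mem_iff _).2 ⟨k - 1, hk', rfl⟩)
      ⟨v.entry 0, v.entry_lt hk⟩ ((v.mem_iff _).2 ⟨0, hk, rfl⟩)
  · intro h x hx y hy
    obtain ⟨a, ha, hax⟩ := (u.mem_iff x).1 hx
    obtain ⟨b, hb, hby⟩ := (v.mem_iff y).1 hy
    rw [Fin.lt_def, ← hax, ← hby]
    exact (u.entry_le_entry (by omega) hk').trans_lt
      (h.trans_le (v.entry_le_entry (Nat.zero_le b) hb))

/-- The column with given entries. -/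
noncomputable def Col.mk {k r : ℕ} (f : ℕ → ℕ) (hf : ∀ a < k, f a < r)
    (hs : ∀ a b, a < b → b < k → f a < f b) : Col k r :=
  ⟨List.ofFn fun a : Fin k => (⟨f a, hf a a.2⟩ : Fin r), by
    rw [mem_sortedWords, List.length_ofFn, List.pairwise_ofFn]
    exact ⟨rfl, fun a b hab => hs a b hab b.2⟩⟩

theorem Col.entry_mk {k r : ℕ} (f : ℕ → ℕ) (hf : ∀ a < k, f a < r)
    (hs : ∀ a b, a < b → b < k → f a < f b) {a : ℕ} (ha : a < k) :
    (Col.mk f hf hs).entry a = f a := by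
  rw [Col.entry_eq _ ha]
  simp [Col.mk]

/-- The `a`-th entry of the `j`-th column of a word. -/
def cellEntry {k r : ℕ} (w : List (Col k r)) (j a : ℕ) : ℕ :=
  (w[j]?.map fun u => u.entry a).getD 0

theorem cellEntry_eq {k r : ℕ} {w : List (Col k r)} {j : ℕ} (hj : j < w.length) (a : ℕ) :
    cellEntry w j a = w[j].entry a := by
  simp [cellEntry, hj]

theorem sum_entry {k r : ℕ} (u : Col k r) (x : Fin r) :
    u.1.count x = ∑ a ∈ Finset.range k, if u.entry a = x then 1 else 0 := by
  have h : ∀ l : List (Fin r), l.count x =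
      ∑ a ∈ Finset.range l.length, if (l.map Fin.val).getD a 0 = x then 1 else 0 := by
    intro l
    induction l with
    | nil => simp
    | cons y l ih =>
      rw [List.count_cons, List.length_cons, Finset.sum_range_succ', ih]
      simp [Fin.ext_iff]
  rw [h, u.length_eq]
  rfl

theorem count_entries {k r : ℕ} (w : List (Col k r)) (x : Fin r) :
    (entries w).count x = ∑ j ∈ Finset.range w.length, ∑ a ∈ Finset.range k,
      if cellEntry w j a = x then 1 else 0 := by
  induction w with
  | nil => simp
  | cons u w ih =>
    rw [entries_cons, List.count_append, List.length_cons, Finset.sum_range_succ', ih, add_comm,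
      sum_entry]
    rfl

theorem noDesc_iff {k r : ℕ} (hk : 0 < k) (w : List (Col k r)) :
    NoDesc colLt w ↔ ∀ j, j + 1 < w.length → cellEntry w j 0 ≤ cellEntry w (j + 1) (k - 1) := by
  rw [NoDesc, List.isChain_iff_getElem]
  refine forall_congr' fun j => forall_congr' fun hj => ?_
  rw [colLt_iff hk, not_lt, cellEntry_eq hj, cellEntry_eq]

/-- The interval from the top to the bottom entry of a column. -/
def Col.interval {k r : ℕ} (u : Col k r) : ℕ × ℕ := (u.entry 0 + 1, u.entry (k - 1) + 1)

/-- Let `p` be the column just read. Its top is at least `L`, and the absence of a descent puts the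
bottom of the next column at or above that top. So the next interval can miss `[L, R]` only by lying
entirely to its right. Since a new segment always starts beyond `R`, the current `R` stays the
largest bottom entry seen so far, and new segments are the left-to-right maxima. -/
theorem greedyFrom_eq {k r : ℕ} (hk : 0 < k) (w : List (Col k r)) (p : Col k r) (L R : ℕ)
    (q : Col k r → Prop) (hw : NoDesc colLt (p :: w)) (hL : L ≤ p.entry 0 + 1) (hLR : L ≤ R)
    (hq : ∀ z, q z ↔ R < z.entry 0 + 1) :
    greedyFrom L R (w.map Col.interval) = 1 + lrMax colLt q w := by
  induction w generalizing p L R q with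
  | nil => rfl
  | cons x w ih =>
    rw [NoDesc, List.isChain_cons_cons, colLt_iff hk] at hw
    have hx := x.entry_le_entry (Nat.zero_le (k - 1)) (by omega : k - 1 < k)
    have hne : (Finset.Icc (x.entry 0 + 1) (x.entry (k - 1) + 1) ∩ Finset.Icc L R).Nonempty ↔
        ¬ q x := by
      rw [hq]
      constructor
      · rintro ⟨z, hz⟩
        simp only [Finset.mem_inter, Finset.mem_Icc] at hz
        omega
      · intro h
        refine ⟨max (x.entry 0 + 1) L, ?_⟩
        simp only [Finset.mem_inter, Finset.mem_Icc]
        omega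
    rw [List.map_cons, Col.interval, greedyFrom, lrMax]
    by_cases hqx : q x
    · rw [if_neg (by rw [hne, not_not]; exact hqx), if_pos hqx,
        ih x _ _ (fun z => q z ∧ colLt x z) hw.2 le_rfl (by omega)]
      intro z
      rw [hq, colLt_iff hk]
      have := (hq x).1 hqx
      omega
    · rw [if_pos (hne.2 hqx), if_neg hqx, zero_add,
        ih x _ _ (fun z => q z ∧ colLt x z) hw.2 (min_le_right _ _) (by omega)]
      intro z
      rw [hq, colLt_iff hk]
      omega

theorem greedySegments_eq {k r : ℕ} (hk : 0 < k) (w : List (Col k r)) (hw : NoDesc colLt w) :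
    greedySegments (w.map Col.interval) = lrMax colLt (fun _ => True) w := by
  cases w with
  | nil => rfl
  | cons x w =>
    have hx := x.entry_le_entry (Nat.zero_le (k - 1)) (by omega : k - 1 < k)
    rw [List.map_cons, Col.interval, greedySegments, lrMax, if_pos trivial,
      greedyFrom_eq hk w x _ _ _ hw le_rfl (by omega)]
    intro z
    rw [colLt_iff hk]
    simp

/-! ### The bijection between ribbon tableaux and descent-free words -/

namespace SSYT

variable {n k m : ℕ} {μ : m.Partition}

/-- The `j`-th column of a tableau, with all entries decreased by one. -/
noncomputable def col (T : SSYT (SH n k 0) μ) (j : Fin n) : Col k μ.parts.card :=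
  Col.mk (fun a => T.entry ((n - 1 - j) * (k - 1) + a, j) - 1)
    (fun a ha => by
      have h1 := T.entry_le ((n - 1 - j) * (k - 1) + a, j)
      have h2 := T.pos _ (cell_mem_SH j.2 ha)
      rw [Multiset.length_sort] at h1
      omega)
    (fun a b hab hb => by
      have h1 := T.col_strict _ _ _ (cell_mem_SH j.2 (hab.trans hb)) (cell_mem_SH j.2 hb)
        (Nat.add_lt_add_left hab _)
      have h2 := T.pos _ (cell_mem_SH j.2 (hab.trans hb))
      omega)

/-- The word of columns of a tableau. -/
noncomputable def word (T : SSYT (SH n k 0) μ) : List (Col k μ.parts.card) := List.ofFn T.col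

theorem length_word (T : SSYT (SH n k 0) μ) : T.word.length = n := List.length_ofFn

theorem cellEntry_word (T : SSYT (SH n k 0) μ) {j a : ℕ} (hj : j < n) (ha : a < k) :
    cellEntry T.word j a + 1 = T.entry ((n - 1 - j) * (k - 1) + a, j) := by
  have h2 := T.pos _ (cell_mem_SH hj ha)
  rw [cellEntry_eq (by rwa [length_word])]
  simp only [word, List.getElem_ofFn, col]
  rw [Col.entry_mk _ _ _ ha]
  omega

theorem word_injective : Function.Injective (word : SSYT (SH n k 0) μ → _) := by
  intro T T' h
  apply SSYT.ext
  funext ⟨i, j⟩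
  by_cases hc : (i, j) ∈ SH n k 0
  · obtain ⟨hj, a, ha, rfl⟩ := mem_SH_zero.1 hc
    rw [← T.cellEntry_word hj ha, ← T'.cellEntry_word hj ha, h]
  · rw [T.zeros _ hc, T'.zeros _ hc]

theorem noDesc_word (hk : 0 < k) (T : SSYT (SH n k 0) μ) : NoDesc colLt T.word := by
  rw [noDesc_iff hk]
  intro j hj
  rw [length_word] at hj
  have hk' : k - 1 < k := by omega
  -- The bottom cell of column `j + 1` shares its row with the top cell of column `j`.
  have e : (n - 1 - (j + 1)) * (k - 1) + (k - 1) = (n - 1 - j) * (k - 1) + 0 := by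
    rw [← Nat.succ_mul, Nat.add_zero]
    congr 1
    omega
  have h1 := T.cellEntry_word (by omega : j < n) hk
  have h2 := T.cellEntry_word hj hk'
  have h3 := T.row_weak _ j (j + 1) (cell_mem_SH (by omega) hk)
    (by rw [← e]; exact cell_mem_SH hj hk') (Nat.lt_succ_self j)
  rw [e] at h2
  omega

theorem count_entries_word (T : SSYT (SH n k 0) μ) (i : Fin μ.parts.card) :
    (entries T.word).count i = partAt μ i := by
  rw [← T.content, Finset.card_filter, sum_SH_zero, count_entries, length_word]
  refine Finset.sum_congr rfl fun j hj => Finset.sum_congr rfl fun a ha => ?_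
  rw [← T.cellEntry_word (Finset.mem_range.1 hj) (Finset.mem_range.1 ha)]
  simp

theorem rMin_eq (hk : 0 < k) (T : SSYT (SH n k 0) μ) :
    rMin T = lrMax colLt (fun _ => True) T.word := by
  rw [← greedySegments_eq hk _ (T.noDesc_word hk), rMin]
  congr 1
  refine List.ext_getElem (by simp [length_word]) fun j h1 h2 => ?_
  have hj : j < n := by simpa using h1
  have hj' : j < T.word.length := by rwa [length_word]
  have hk' : k - 1 < k := by omega
  simp only [List.getElem_map, List.getElem_range, extremeInterval, Col.interval]
  rw [← cellEntry_eq hj', ← cellEntry_eq hj', T.cellEntry_word hj hk, T.cellEntry_word hj hk']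
  rfl

/-- For k ≥ 2 two cells in one row must be the top and the bottom of adjacent columns, which is the
descent condition itself. For k = 1 the ribbon is a single row and the adjacent inequalities are
chained. -/
theorem cellEntry_le_of_row {w : List (Col k μ.parts.card)} (hk : 0 < k) (hw : NoDesc colLt w)
    {j₁ j₂ a₁ a₂ : ℕ} (h : j₁ < j₂) (h₂ : j₂ < w.length) (ha : a₂ < k)
    (e : (w.length - 1 - j₁) * (k - 1) + a₁ = (w.length - 1 - j₂) * (k - 1) + a₂) :
    cellEntry w j₁ a₁ ≤ cellEntry w j₂ a₂ := by
  rw [noDesc_iff hk] at hw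
  obtain ⟨d, rfl⟩ := Nat.exists_eq_add_of_lt h
  have e' : a₂ = (d + 1) * (k - 1) + a₁ := by
    have : w.length - 1 - j₁ = (w.length - 1 - (j₁ + d + 1)) + (d + 1) := by omega
    rw [this, add_mul] at e
    omega
  obtain ⟨K, rfl⟩ := Nat.exists_eq_add_of_lt hk
  simp only [zero_add, Nat.add_sub_cancel] at *
  rcases Nat.eq_zero_or_pos K with rfl | hK
  · obtain rfl : a₁ = 0 := by omega
    obtain rfl : a₂ = 0 := by omega
    clear e e' h
    induction d with
    | zero => exact hw _ h₂
    | succ d ih => exact (ih (by omega)).trans (hw _ h₂)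
  · rw [add_mul, one_mul] at e'
    obtain rfl : d = 0 := by
      by_contra hd
      have : K ≤ d * K := Nat.le_mul_of_pos_left K (Nat.pos_of_ne_zero hd)
      omega
    obtain rfl : a₁ = 0 := by omega
    obtain rfl : a₂ = K := by omega
    exact hw _ h₂

theorem exists_word_eq (hk : 0 < k) {w : List (Col k μ.parts.card)} (hn : w.length = n)
    (hw : NoDesc colLt w) (hc : ∀ i, (entries w).count i = partAt μ i) :
    ∃ T : SSYT (SH n k 0) μ, T.word = w := by
  classical
  subst hn
  set n := w.length with hn
  let f : ℕ × ℕ → ℕ := fun c =>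
    if c ∈ SH n k 0 then cellEntry w c.2 (c.1 - (n - 1 - c.2) * (k - 1)) + 1 else 0
  have hf : ∀ j a, j < n → a < k → f ((n - 1 - j) * (k - 1) + a, j) = cellEntry w j a + 1 := by
    intro j a hj ha
    simp only [f]
    rw [if_pos (cell_mem_SH hj ha), Nat.add_sub_cancel_left]
  have hlt : ∀ j a, j < n → a < k → cellEntry w j a < μ.parts.card := fun j a hj ha => by
    rw [cellEntry_eq hj]
    exact Col.entry_lt _ ha
  let T : SSYT (SH n k 0) μ :=
    { entry := f
      pos := by
        rintro ⟨i, j⟩ h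
        obtain ⟨hj, a, ha, rfl⟩ := mem_SH_zero.1 h
        rw [hf j a hj ha]
        omega
      row_weak := by
        intro i j₁ j₂ h₁ h₂ h
        obtain ⟨hj₁, a₁, ha₁, rfl⟩ := mem_SH_zero.1 h₁
        obtain ⟨hj₂, a₂, ha₂, e⟩ := mem_SH_zero.1 h₂
        rw [hf j₁ a₁ hj₁ ha₁, e, hf j₂ a₂ hj₂ ha₂]
        exact Nat.succ_le_succ (cellEntry_le_of_row hk hw h hj₂ ha₂ e)
      col_strict := by
        intro i₁ i₂ j h₁ h₂ h
        obtain ⟨hj, a₁, ha₁, rfl⟩ := mem_SH_zero.1 h₁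
        obtain ⟨-, a₂, ha₂, rfl⟩ := mem_SH_zero.1 h₂
        rw [hf j a₁ hj ha₁, hf j a₂ hj ha₂, cellEntry_eq hj, cellEntry_eq hj]
        exact Nat.succ_lt_succ (Col.entry_lt_entry _ (by omega) ha₂)
      content := by
        intro v
        have h1 : (Finset.filter (fun c => f c = v + 1) (SH n k 0)).card =
            ∑ j ∈ Finset.range n, ∑ a ∈ Finset.range k, if cellEntry w j a = v then 1 else 0 := by
          rw [Finset.card_filter, sum_SH_zero]
          refine Finset.sum_congr rfl fun j hj => Finset.sum_congr rfl fun a ha => ?_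
          rw [hf j a (Finset.mem_range.1 hj) (Finset.mem_range.1 ha)]
          simp
        rw [h1]
        by_cases hv : v < μ.parts.card
        · rw [← hc ⟨v, hv⟩, count_entries]
        · have h0 : partAt μ v = 0 := List.getD_eq_default _ _ (by simpa using hv)
          rw [h0]
          refine Finset.sum_eq_zero fun j hj => Finset.sum_eq_zero fun a ha => if_neg ?_
          have := hlt j a (Finset.mem_range.1 hj) (Finset.mem_range.1 ha)
          omega
      zeros := fun c hc => if_neg hc }
  refine ⟨T, List.ext_getElem (T.length_word.trans hn) fun j h1 h2 => Col.ext_entry fun a ha => ?_⟩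
  have h3 := T.cellEntry_word h2 ha
  rw [← cellEntry_eq h1, ← cellEntry_eq h2]
  have h4 := hf j a h2 ha
  change _ = f _ at h3
  omega

end SSYT

open Classical in
theorem sum_words_eq_sum_SSYT {M : Type*} [AddCommMonoid M] {n k m : ℕ} (hk : 0 < k)
    (μ : m.Partition) (g : ℕ → M) :
    ∑ w ∈ words (Col k μ.parts.card) n with
        NoDesc colLt w ∧ ∀ i, (entries w).count i = partAt μ i,
        g (lrMax colLt (fun _ => True) w) =
      ∑ T : SSYT (SH n k 0) μ, g (rMin T) := by
  symm
  refine Finset.sum_bij (fun T _ => T.word) ?_ ?_ ?_ ?_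
  · intro T _
    rw [Finset.mem_filter, mem_words]
    exact ⟨T.length_word, T.noDesc_word hk, T.count_entries_word⟩
  · exact fun T _ T' _ h => SSYT.word_injective h
  · intro w hw
    rw [Finset.mem_filter, mem_words] at hw
    obtain ⟨T, hT⟩ := SSYT.exists_word_eq hk hw.1 hw.2.1 hw.2.2
    exact ⟨T, Finset.mem_univ _, hT⟩
  · intro T _
    rw [T.rMin_eq hk]

end RowDivision

/-! ### Comparison of the two evaluations of the functional -/

theorem mainTheorem10 (n k : ℕ) (hk : 0 < k) (μ : (k * n).Partition) :
    ∃ c : n.Partition → ℚ,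
      -- `c ν` is the coefficient of `e_ν` in `row_k (e_μ)`: the expansion exists and is unique
      (∀ c' : n.Partition → ℚ,
        RowDivision.rowMap k (RowDivision.elemSymmPart μ) =
            ∑ ν : n.Partition, c' ν • RowDivision.elemSymmPart ν ↔ c' = c) ∧
      (∑ ν : n.Partition, Polynomial.C (c ν) * (Polynomial.X : Polynomial ℚ) ^ ν.parts.card =
        ∑ T : RowDivision.SSYT (RowDivision.SH n k 0) μ,
          (Polynomial.X : Polynomial ℚ) ^ RowDivision.rMin T) ∧
      (∀ r : ℕ, 1 ≤ r → r ≤ n →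
        ∑ ν : n.Partition with ν.parts.card = r, c ν =
          (Nat.card {T : RowDivision.SSYT (RowDivision.SH n k 0) μ // RowDivision.rMin T = r} :
            ℚ)) := by
  classical
  obtain ⟨c, hc⟩ := RowDivision.exists_elemSymmPart_expansion
    (RowDivision.rowMap_elemSymmPart_mem hk μ)
  have hpoly : ∑ ν : n.Partition, Polynomial.C (c ν) * (Polynomial.X : Polynomial ℚ) ^ ν.parts.card =
      ∑ T : RowDivision.SSYT (RowDivision.SH n k 0) μ,
        (Polynomial.X : Polynomial ℚ) ^ RowDivision.rMin T := by
    have h := congrArg (RowDivision.lengthFunctional n) hc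
    rw [RowDivision.lengthFunctional_rowMap hk,
      RowDivision.sum_words_eq_sum_SSYT hk μ fun a => (Polynomial.X : Polynomial ℚ) ^ a,
      map_sum] at h
    rw [h]
    refine Finset.sum_congr rfl fun ν _ => ?_
    rw [map_smul, RowDivision.lengthFunctional_elemSymmPart, Polynomial.smul_eq_C_mul]
  refine ⟨c, fun c' => ⟨fun h => ?_, fun h => h ▸ hc⟩, hpoly, fun r _ _ => ?_⟩
  · have h0 : ∑ ν, (c' ν - c ν) • RowDivision.elemSymmPart ν = 0 := by
      simp only [sub_smul, Finset.sum_sub_distrib]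
      rw [← h, ← hc, sub_self]
    funext ν
    exact sub_eq_zero.1
      (Fintype.linearIndependent_iff.1 (RowDivision.linearIndependent_elemSymmPart n) _ h0 ν)
  · have h := congrArg (fun p => Polynomial.coeff p r) hpoly
    simp only [Polynomial.finsetSum_coeff, Polynomial.coeff_C_mul, Polynomial.coeff_X_pow,
      mul_ite, mul_one, mul_zero] at h
    rw [Nat.card_eq_fintype_card, Fintype.card_subtype, Finset.card_filter]
    push_cast
    rw [Finset.sum_filter]
    simpa only [eq_comm] using h
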